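/- Let $k$ be a field and let $A$ and $B$ be (unital, associative) $k$-algebras. Let $M$ be a $B$-$A$-bimodule and $N$ an $A$-$B$-bimodule, with $k$ acting centrally on both. Put $\mathbb A=A\times B$ and $\mathbb M=M\oplus N$, the $\mathbb A$-bimodule with actions $(a,b)(m,n)(a',b')=(bma',\,anb')$. Let $$\Lambda=\begin{pmatrix}A&N\\ M&B\end{pmatrix}$$ be the null-square algebra, with product $$\begin{pmatrix}a&n\\ m&b\end{pmatrix}\begin{pmatrix}a'&n'\\ m'&b'\end{pmatrix}=\begin{pmatrix}aa'&an'+nb'\\ ma'+bm'&bb'\end{pmatrix},$$ so that the products $NM$ and $MN$ are zero. Suppose that $\Lambda$ is null-square projective, i.e. that $\mathbb M$ is a projective $\mathbb A$-bimodule (a projective $\mathbb A\otimes_k\mathbb A^{\mathrm{op}}$-module); equivalently, $M$ and $N$ are projective bimodules. For a $k$-algebra $R$ let $HH^n(R)=\operatorname{Ext}^n_{R\otimes_k R^{\mathrm{op}}}(R,R)$ denote its Hochschild cohomology. 1. If $\Lambda$ is finite dimensional over $k$, then for every $n>0$ $$\dim_k HH^n(\Lambda)\ \ge\ \dim_k HH^n(A)+\dim_k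 HH^n(B).$$ 2. If there is a positive integer $h$ such that $\mathbb M^{\otimes_{\mathbb A}h}=0$, then for every $n\ge h$ there is an isomorphism of $k$-vector spaces $$HH^n(\Lambda)\ \cong\ HH^n(A)\oplus HH^n(B).$$ -/

import Mathlib

open CategoryTheory TensorProduct MulOpposite

universe u

section Bimodules

variable (k : Type u) [Field k]

/-- The `S`-`R`-bimodule `X` (on which `k` acts centrally) is projective, i.e. it is a projective
left module over `S ⊗[k] Rᵐᵒᵖ`, where `(s ⊗ op r) • x = s x r`. -/
def IsProjectiveBimodule (S R X : Type u) [Ring S] [Algebra k S] [Ring R] [Algebra k R]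
    [AddCommGroup X] [Module k X] [Module S X] [Module Rᵐᵒᵖ X] [SMulCommClass S Rᵐᵒᵖ X]
    [IsScalarTower k S X] [IsScalarTower k Rᵐᵒᵖ X] : Prop :=
  letI : Module (S ⊗[k] Rᵐᵒᵖ) X := TensorProduct.Algebra.module
  Module.Projective (S ⊗[k] Rᵐᵒᵖ) X

/-- The relations `x₁ ⊗ ⋯ ⊗ xᵢ r ⊗ xᵢ₊₁ ⊗ ⋯ ⊗ x_h = x₁ ⊗ ⋯ ⊗ xᵢ ⊗ r xᵢ₊₁ ⊗ ⋯ ⊗ x_h`, for `r : R`,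
between two consecutive factors of the `h`-fold tensor power over `k` of an `R`-bimodule `X`. -/
def balancedRelations (R X : Type u) [Ring R] [AddCommGroup X] [Module k X] [Module R X]
    [Module Rᵐᵒᵖ X] (h : ℕ) : Submodule k (⨂[k] _ : Fin h, X) :=
  Submodule.span k
    {t | ∃ (x : Fin h → X) (r : R) (i j : Fin h), (i : ℕ) + 1 = j ∧
      t = PiTensorProduct.tprod k (Function.update x i (op r • x i)) -
        PiTensorProduct.tprod k (Function.update x j (r • x j))}

/-- The underlying `k`-vector space of the `h`-fold tensor power `X ⊗_R ⋯ ⊗_R X` of an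
`R`-bimodule `X` over the (noncommutative) `k`-algebra `R`, for `h ≥ 1`. -/
abbrev BimoduleTensorPower (R X : Type u) [Ring R] [AddCommGroup X] [Module k X] [Module R X]
    [Module Rᵐᵒᵖ X] (h : ℕ) : Type u :=
  (⨂[k] _ : Fin h, X) ⧸ balancedRelations k R X h

end Bimodules

section Hochschild

variable (k : Type u) [Field k] (A : Type u) [Ring A] [Algebra k A]

/-- The algebra `A` as a bimodule over itself, i.e. as a left module over the enveloping algebra
`A ⊗[k] Aᵐᵒᵖ`, with `(a ⊗ op b) • x = a x b`. -/
noncomputable def regularBimodule : ModuleCat.{u} (A ⊗[k] Aᵐᵒᵖ) :=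
  letI : Module (A ⊗[k] Aᵐᵒᵖ) A := TensorProduct.Algebra.module
  ModuleCat.of (A ⊗[k] Aᵐᵒᵖ) A

/-- `H^n(A, Z) = Ext^n_{A ⊗ Aᵒᵖ}(A, Z)`, a `k`-vector space. -/
abbrev HochschildCohomologyWith (Z : ModuleCat.{u} (A ⊗[k] Aᵐᵒᵖ)) (n : ℕ) : Type u :=
  Abelian.Ext (regularBimodule k A) Z n

/-- `HH^n(A) = H^n(A, A)`. -/
abbrev HochschildCohomology (n : ℕ) : Type u :=
  HochschildCohomologyWith k A (regularBimodule k A) n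

end Hochschild

/-- The set of matrices `!![a, n; m, b]` with `a : A`, `n : N`, `m : M`, `b : B`. -/
@[ext]
structure NullSquareAlgebra (A N M B : Type u) : Type u where
  a : A
  n : N
  m : M
  b : B

namespace NullSquareAlgebra

variable {A N M B : Type u}

/-- The four entries of a matrix. -/
def entries : NullSquareAlgebra A N M B ≃ A × N × M × B where
  toFun x := (x.a, x.n, x.m, x.b)
  invFun x := ⟨x.1, x.2.1, x.2.2.1, x.2.2.2⟩

section Additive

variable [Ring A] [Ring B] [AddCommGroup M] [AddCommGroup N]

instance : AddCommGroup (NullSquareAlgebra A N M B) := entries.addCommGroup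

@[simp] theorem zero_a : (0 : NullSquareAlgebra A N M B).a = 0 := rfl
@[simp] theorem zero_n : (0 : NullSquareAlgebra A N M B).n = 0 := rfl
@[simp] theorem zero_m : (0 : NullSquareAlgebra A N M B).m = 0 := rfl
@[simp] theorem zero_b : (0 : NullSquareAlgebra A N M B).b = 0 := rfl
@[simp] theorem add_a (x y : NullSquareAlgebra A N M B) : (x + y).a = x.a + y.a := rfl
@[simp] theorem add_n (x y : NullSquareAlgebra A N M B) : (x + y).n = x.n + y.n := rfl
@[simp] theorem add_m (x y : NullSquareAlgebra A N M B) : (x + y).m = x.m + y.m := rfl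
@[simp] theorem add_b (x y : NullSquareAlgebra A N M B) : (x + y).b = x.b + y.b := rfl

end Additive

section Ring

variable [Ring A] [Ring B] [AddCommGroup M] [AddCommGroup N]

instance : One (NullSquareAlgebra A N M B) := ⟨⟨1, 0, 0, 1⟩⟩

@[simp] theorem one_a : (1 : NullSquareAlgebra A N M B).a = 1 := rfl
@[simp] theorem one_n : (1 : NullSquareAlgebra A N M B).n = 0 := rfl
@[simp] theorem one_m : (1 : NullSquareAlgebra A N M B).m = 0 := rfl
@[simp] theorem one_b : (1 : NullSquareAlgebra A N M B).b = 1 := rfl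

variable [Module B M] [Module Aᵐᵒᵖ M] [Module A N] [Module Bᵐᵒᵖ N]

/-- Matrix multiplication, where the products `M × N → B` and `N × M → A` are zero. -/
instance : Mul (NullSquareAlgebra A N M B) :=
  ⟨fun x y => ⟨x.a * y.a, x.a • y.n + op y.b • x.n, op y.a • x.m + x.b • y.m, x.b * y.b⟩⟩

@[simp] theorem mul_a (x y : NullSquareAlgebra A N M B) : (x * y).a = x.a * y.a := rfl
@[simp] theorem mul_n (x y : NullSquareAlgebra A N M B) :
    (x * y).n = x.a • y.n + op y.b • x.n := rfl
@[simp] theorem mul_m (x y : NullSquareAlgebra A N M B) :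
    (x * y).m = op y.a • x.m + x.b • y.m := rfl
@[simp] theorem mul_b (x y : NullSquareAlgebra A N M B) : (x * y).b = x.b * y.b := rfl

variable [SMulCommClass B Aᵐᵒᵖ M] [SMulCommClass A Bᵐᵒᵖ N]

instance : Ring (NullSquareAlgebra A N M B) where
  __ := (inferInstance : AddCommGroup (NullSquareAlgebra A N M B))
  left_distrib x y z := by
    ext <;> simp [mul_add, add_smul] <;> abel
  right_distrib x y z := by
    ext <;> simp [add_mul, add_smul] <;> abel
  zero_mul x := by ext <;> simp
  mul_zero x := by ext <;> simp
  mul_assoc x y z := by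
    ext
    · simp [mul_assoc]
    · simp [mul_smul, smul_comm x.a (op z.b) y.n, add_assoc]
    · simp [mul_smul, smul_comm x.b (op z.a) y.m, add_assoc]
    · simp [mul_assoc]
  one_mul x := by ext <;> simp
  mul_one x := by ext <;> simp

variable {k : Type u} [Field k] [Algebra k A] [Algebra k B] [Module k M] [Module k N]

instance : Module k (NullSquareAlgebra A N M B) := entries.module k

@[simp] theorem smul_a (c : k) (x : NullSquareAlgebra A N M B) : (c • x).a = c • x.a := rfl
@[simp] theorem smul_n (c : k) (x : NullSquareAlgebra A N M B) : (c • x).n = c • x.n := rfl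
@[simp] theorem smul_m (c : k) (x : NullSquareAlgebra A N M B) : (c • x).m = c • x.m := rfl
@[simp] theorem smul_b (c : k) (x : NullSquareAlgebra A N M B) : (c • x).b = c • x.b := rfl

instance [IsScalarTower k B M] [IsScalarTower k Aᵐᵒᵖ M] [IsScalarTower k A N]
    [IsScalarTower k Bᵐᵒᵖ N] : Algebra k (NullSquareAlgebra A N M B) :=
  Algebra.ofModule
    (fun c x y => by
      ext
      · simp
      · simp [smul_comm c (op y.b) x.n]
      · simp [smul_comm c (op y.a) x.m]
      · simp)
    (fun c x y => by
      ext
      · simp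
      · simp [smul_comm c x.a y.n]
      · simp [smul_comm c x.b y.m]
      · simp)

end Ring

end NullSquareAlgebra

/-- The bimodule `M ⊕ N` over `A × B` formed by a `B`-`A`-bimodule `M` and an `A`-`B`-bimodule `N`,
with `(a, b) (m, n) (a', b') = (b m a', a n b')`. -/
@[ext]
structure CornerBimodule (M N : Type u) : Type u where
  m : M
  n : N

namespace CornerBimodule

variable {M N : Type u}

/-- The two components. -/
def components : CornerBimodule M N ≃ M × N where
  toFun x := (x.m, x.n)
  invFun x := ⟨x.1, x.2⟩

variable [AddCommGroup M] [AddCommGroup N]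

instance : AddCommGroup (CornerBimodule M N) := components.addCommGroup

@[simp] theorem zero_m : (0 : CornerBimodule M N).m = 0 := rfl
@[simp] theorem zero_n : (0 : CornerBimodule M N).n = 0 := rfl
@[simp] theorem add_m (x y : CornerBimodule M N) : (x + y).m = x.m + y.m := rfl
@[simp] theorem add_n (x y : CornerBimodule M N) : (x + y).n = x.n + y.n := rfl

instance {k : Type u} [Field k] [Module k M] [Module k N] : Module k (CornerBimodule M N) :=
  components.module k

@[simp] theorem smul_m {k : Type u} [Field k] [Module k M] [Module k N] (c : k)
    (x : CornerBimodule M N) : (c • x).m = c • x.m := rfl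
@[simp] theorem smul_n {k : Type u} [Field k] [Module k M] [Module k N] (c : k)
    (x : CornerBimodule M N) : (c • x).n = c • x.n := rfl

variable {A B : Type u} [Ring A] [Ring B]

/-- Left action: `(a, b) (m, n) = (b m, a n)`. -/
instance [Module B M] [Module A N] : Module (A × B) (CornerBimodule M N) where
  smul r x := ⟨r.2 • x.m, r.1 • x.n⟩
  one_smul x := CornerBimodule.ext (one_smul B x.m) (one_smul A x.n)
  mul_smul r s x := CornerBimodule.ext (mul_smul r.2 s.2 x.m) (mul_smul r.1 s.1 x.n)
  smul_zero r := CornerBimodule.ext (smul_zero r.2) (smul_zero r.1)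
  smul_add r x y := CornerBimodule.ext (smul_add r.2 x.m y.m) (smul_add r.1 x.n y.n)
  add_smul r s x := CornerBimodule.ext (add_smul r.2 s.2 x.m) (add_smul r.1 s.1 x.n)
  zero_smul x := CornerBimodule.ext (zero_smul B x.m) (zero_smul A x.n)

@[simp] theorem prod_smul_m [Module B M] [Module A N] (r : A × B) (x : CornerBimodule M N) :
    (r • x).m = r.2 • x.m := rfl
@[simp] theorem prod_smul_n [Module B M] [Module A N] (r : A × B) (x : CornerBimodule M N) :
    (r • x).n = r.1 • x.n := rfl

/-- Right action: `(m, n) (a, b) = (m a, n b)`. -/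
instance [Module Aᵐᵒᵖ M] [Module Bᵐᵒᵖ N] : Module (A × B)ᵐᵒᵖ (CornerBimodule M N) where
  smul r x := ⟨op r.unop.1 • x.m, op r.unop.2 • x.n⟩
  one_smul x := CornerBimodule.ext (one_smul Aᵐᵒᵖ x.m) (one_smul Bᵐᵒᵖ x.n)
  mul_smul r s x := CornerBimodule.ext (mul_smul (op r.unop.1) (op s.unop.1) x.m)
    (mul_smul (op r.unop.2) (op s.unop.2) x.n)
  smul_zero r := CornerBimodule.ext (smul_zero (op r.unop.1)) (smul_zero (op r.unop.2))
  smul_add r x y := CornerBimodule.ext (smul_add (op r.unop.1) x.m y.m)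
    (smul_add (op r.unop.2) x.n y.n)
  add_smul r s x := CornerBimodule.ext (add_smul (op r.unop.1) (op s.unop.1) x.m)
    (add_smul (op r.unop.2) (op s.unop.2) x.n)
  zero_smul x := CornerBimodule.ext (zero_smul Aᵐᵒᵖ x.m) (zero_smul Bᵐᵒᵖ x.n)

@[simp] theorem op_prod_smul_m [Module Aᵐᵒᵖ M] [Module Bᵐᵒᵖ N] (r : (A × B)ᵐᵒᵖ)
    (x : CornerBimodule M N) : (r • x).m = op r.unop.1 • x.m := rfl
@[simp] theorem op_prod_smul_n [Module Aᵐᵒᵖ M] [Module Bᵐᵒᵖ N] (r : (A × B)ᵐᵒᵖ)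
    (x : CornerBimodule M N) : (r • x).n = op r.unop.2 • x.n := rfl

instance [Module B M] [Module A N] [Module Aᵐᵒᵖ M] [Module Bᵐᵒᵖ N]
    [SMulCommClass B Aᵐᵒᵖ M] [SMulCommClass A Bᵐᵒᵖ N] :
    SMulCommClass (A × B) (A × B)ᵐᵒᵖ (CornerBimodule M N) where
  smul_comm r s x := CornerBimodule.ext (smul_comm r.2 (op s.unop.1) x.m)
    (smul_comm r.1 (op s.unop.2) x.n)

variable {k : Type u} [Field k] [Algebra k A] [Algebra k B] [Module k M] [Module k N]

instance [Module B M] [Module A N] [IsScalarTower k B M] [IsScalarTower k A N] :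
    IsScalarTower k (A × B) (CornerBimodule M N) where
  smul_assoc c r x := CornerBimodule.ext (smul_assoc c r.2 x.m) (smul_assoc c r.1 x.n)

instance [Module Aᵐᵒᵖ M] [Module Bᵐᵒᵖ N] [IsScalarTower k Aᵐᵒᵖ M] [IsScalarTower k Bᵐᵒᵖ N] :
    IsScalarTower k (A × B)ᵐᵒᵖ (CornerBimodule M N) where
  smul_assoc c r x := CornerBimodule.ext (smul_assoc c (op r.unop.1) x.m)
    (smul_assoc c (op r.unop.2) x.n)

end CornerBimodule

/-!
Let `E = A × B`, a subalgebra of the null-square algebra `Λ`; then `Λ = E ⊕ 𝕄` is the trivial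
extension of `E` by the bimodule `𝕄 = M ⊕ N`. Restricting a class of `Ext_{Λᵉ}(Λ, Λ)` along
`E → Λ` on both sides, pulling it back along the inclusion `E → Λ` and pushing it forward along the
projection `Λ → E` gives a linear map `HHⁿ(Λ) → HHⁿ(E)` (`TrivialExtension.restriction`). Moreover
`HHⁿ(E) = HHⁿ(A) × HHⁿ(B)`, because `A` and `B` are modules over different blocks of `Eᵉ`
(`DirectFactor.nonempty_hochschildCohomology_linearEquiv_prod`). Both parts of the theorem follow
once the restriction is known to be surjective in all positive degrees and injective in degrees
`n ≥ h` when `𝕄 ^ {⊗ h} = 0`.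

*Surjectivity* (`TrivialExtension.restriction_surjective`). By dimension shifting every class in
`Extⁿ(E, E)`, `n ≥ 1`, is a product `τ · [0 → Y' → P → Y → 0] · f` with `f : Y' → E`, where the
sequence splits as a sequence of left and as a sequence of right modules. Inflate `τ` and the
sequence along `Λ → E`. The inflated `f` takes values in the quotient bimodule `E` of `Λ` and need not
lift to `Λ`. But `f` extends to a left linear and to a right linear functional `P → E`, and as `𝕄` is
projective these suffice to define products `𝕄 × P → 𝕄` and `P × 𝕄 → 𝕄` which extend
`(m, y) ↦ m f(y)` and `(y, m) ↦ f(y) m` and turn `𝕄 × P` into a `Λ`-bimodule. Its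
sub-bimodule `𝕄 × Y'` maps to `Λ` by `(m, y) ↦ f y + m`, and the extension
`0 → 𝕄 × Y' → 𝕄 × P → Y → 0` provides the required class (`TrivialExtension.glueSeq_shortExact`,
`TrivialExtension.restriction_comp_infl`).

*Injectivity* (`TrivialExtension.restriction_injective`). The restriction is done one side at a
time, along `Λ ⊗ Λᵒᵖ ← E ⊗ Λᵒᵖ ← E ⊗ Eᵒᵖ`. For a split extension `S → T` of this kind, let the
cosyzygy of a `T`-module `Y` be the cokernel of `Y → Hom_S(T, Y)`; its elements are the `E`-linear
maps `𝕄 → Y`. A class which vanishes over `S` comes from a class with values in the cosyzygy, and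
cosyzygies have no higher extensions over `S`, since they are relatively injective. On the left
side, iterating this moves a class which vanishes over `S` into the `h`-th cosyzygy, which consists
of balanced multilinear maps on `𝕄 ^ h` and hence is zero
(`SplitExtension.eq_zero_of_res_eq_zero_of_subsingleton`). On the right side, the argument ends in
degree zero, where morphisms from `Λ` to a cosyzygy lift to the coinduced module
(`SplitExtension.eq_zero_of_comp_res_eq_zero`, `TrivialExtension.exists_lift_toCosyzygy`). The
components of `Λ = E ⊕ 𝕄` not seen by the restriction do not contribute, as `𝕄` is projective and
`Ext_{Eᵉ}(E, 𝕄) = 0`, the bimodule `E` being diagonal and `𝕄` off-diagonal.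
-/

set_option linter.unusedSectionVars false

/-! ### Naturality of the action of exact functors on `Ext` -/

section ExtFunctoriality

open Limits Abelian

universe w w' w'' v₁ v₂ v₃ u₁ u₂ u₃

variable {C : Type u₁} [Category.{v₁} C] [Abelian C] [HasExt.{w} C]

/-- In an abelian category with enough projectives, every `Ext`-class is a composite of morphisms
and of classes of short exact sequences. -/
theorem ext_induction_of_enoughProjectives [EnoughProjectives C]
    {motive : ∀ {X Y : C} {n : ℕ}, Ext.{w} X Y n → Prop}
    (mk₀ : ∀ {X Y : C} (f : X ⟶ Y), motive (Ext.mk₀ f))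
    (extClass : ∀ {S : ShortComplex C} (hS : S.ShortExact), motive hS.extClass)
    (comp : ∀ {X Y Z : C} {a b c : ℕ} (x : Ext.{w} X Y a) (y : Ext.{w} Y Z b) (h : a + b = c),
      motive x → motive y → motive (x.comp y h))
    {X Y : C} {n : ℕ} (x : Ext.{w} X Y n) : motive x := by
  induction n generalizing X with
  | zero =>
    obtain ⟨f, rfl⟩ := (Ext.mk₀_bijective X Y).2 x
    exact mk₀ f
  | succ n ih =>
    let P : ProjectivePresentation X := Classical.arbitrary _
    let S := ShortComplex.mk _ _ (kernel.condition P.f)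
    have hS : S.ShortExact := { exact := ShortComplex.exact_kernel P.f }
    have : Projective S.X₂ := P.projective
    obtain ⟨y, rfl⟩ := Ext.contravariant_sequence_exact₃ hS Y x
      (Ext.eq_zero_of_projective _) (add_comm 1 n)
    exact comp _ _ _ (extClass hS) (ih y)

variable {D : Type u₂} [Category.{v₂} D] [Abelian D] [HasExt.{w'} D]

/-- A natural transformation between exact functors is natural with respect to `Ext`-classes. -/
theorem mapExactFunctor_comp_natTrans_app [EnoughProjectives C] {F G : C ⥤ D} [F.Additive]
    [PreservesFiniteLimits F] [PreservesFiniteColimits F] [G.Additive]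
    [PreservesFiniteLimits G] [PreservesFiniteColimits G] (η : F ⟶ G)
    {X Y : C} {n : ℕ} (x : Ext.{w} X Y n) :
    (x.mapExactFunctor F).comp (Ext.mk₀ (η.app Y)) (add_zero n) =
      (Ext.mk₀ (η.app X)).comp (x.mapExactFunctor G) (zero_add n) := by
  induction x using ext_induction_of_enoughProjectives with
  | mk₀ f => simp [Ext.mapExactFunctor_mk₀]
  | extClass hS =>
    rename_i S
    rw [Ext.mapExactFunctor_extClass, Ext.mapExactFunctor_extClass]
    exact (hS.map_of_exact F).extClass_naturality (hS.map_of_exact G) (S.mapNatTrans η)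
  | comp x y h hx hy =>
    rename_i X Y Z a b c
    rw [Ext.mapExactFunctor_comp, Ext.mapExactFunctor_comp, Ext.comp_assoc _ _ _ h
      (add_zero b) (by lia), hy, ← Ext.comp_assoc _ _ _ (add_zero a) (zero_add b) (by lia),
      hx, Ext.comp_assoc _ _ _ (zero_add a) h (by lia)]

theorem mapExactFunctor_id [EnoughProjectives C] {X Y : C} {n : ℕ} (x : Ext.{w} X Y n) :
    x.mapExactFunctor (𝟭 C) = x := by
  induction x using ext_induction_of_enoughProjectives with
  | mk₀ f => simp [Ext.mapExactFunctor_mk₀]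
  | extClass hS => rw [Ext.mapExactFunctor_extClass]; rfl
  | comp x y h hx hy => rw [Ext.mapExactFunctor_comp, hx, hy]

variable {D' : Type u₃} [Category.{v₃} D'] [Abelian D'] [HasExt.{w''} D']

theorem mapExactFunctor_comp_functor [EnoughProjectives C] (F : C ⥤ D) [F.Additive]
    [PreservesFiniteLimits F] [PreservesFiniteColimits F] (G : D ⥤ D') [G.Additive]
    [PreservesFiniteLimits G] [PreservesFiniteColimits G] {X Y : C} {n : ℕ}
    (x : Ext.{w} X Y n) :
    x.mapExactFunctor (F ⋙ G) = (x.mapExactFunctor F).mapExactFunctor G := by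
  induction x using ext_induction_of_enoughProjectives with
  | mk₀ f => simp [Ext.mapExactFunctor_mk₀]
  | extClass hS =>
    rw [Ext.mapExactFunctor_extClass F hS]
    exact (Ext.mapExactFunctor_extClass (F ⋙ G) hS).trans
      (Ext.mapExactFunctor_extClass G (hS.map_of_exact F)).symm
  | comp x y h hx hy => rw [Ext.mapExactFunctor_comp, Ext.mapExactFunctor_comp,
      Ext.mapExactFunctor_comp, hx, hy]

/-- For exact functors `F` and `G` with a natural transformation `𝟭 ⟶ F ⋙ G`, such as the unit of
an adjunction, a class annihilated by `F` becomes zero when pushed forward along `Y ⟶ G (F Y)`: by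
naturality the push-forward is a pull-back of the image of the class under `F ⋙ G`. -/
theorem comp_unit_eq_zero_of_mapExactFunctor_eq_zero [EnoughProjectives C] {F : C ⥤ D} {G : D ⥤ C}
    [F.Additive] [PreservesFiniteLimits F] [PreservesFiniteColimits F] [G.Additive]
    [PreservesFiniteLimits G] [PreservesFiniteColimits G] (η : 𝟭 C ⟶ F ⋙ G)
    {X Y : C} {n : ℕ} (x : Ext.{w} X Y n) (hx : x.mapExactFunctor F = 0) :
    x.comp (Ext.mk₀ (η.app Y)) (add_zero n) = 0 := by
  have h := mapExactFunctor_comp_natTrans_app η x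
  rw [mapExactFunctor_id, mapExactFunctor_comp_functor, hx, Ext.mapExactFunctor_zero,
    Ext.comp_zero] at h
  exact h

end ExtFunctoriality

/-! ### Restriction and coextension of scalars -/

section ChangeOfRings

open Limits

variable {S T : Type u} [Ring S] [Ring T] (f : S →+* T)

theorem restrictScalars_preservesFiniteLimits_and_colimits :
    PreservesFiniteLimits (ModuleCat.restrictScalars.{u} f) ∧
      PreservesFiniteColimits (ModuleCat.restrictScalars.{u} f) := by
  refine ((Functor.exact_tfae (ModuleCat.restrictScalars.{u} f)).out 1 3).mp fun K hK => ?_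
  rw [ShortComplex.ShortExact.moduleCat_exact_iff_function_exact] at hK ⊢
  exact hK

instance : PreservesFiniteLimits (ModuleCat.restrictScalars.{u} f) :=
  (restrictScalars_preservesFiniteLimits_and_colimits f).1

instance : (ModuleCat.coextendScalars.{u, u, u} f).Additive where
  map_add := by intros; ext; rfl

/-- Coextension of scalars along `f : S →+* T` is exact when `T` is projective over `S`. -/
theorem coextendScalars_preservesEpimorphisms
    [Module.Projective S ((ModuleCat.restrictScalars f).obj (ModuleCat.of T T))] :
    (ModuleCat.coextendScalars.{u, u, u} f).PreservesEpimorphisms where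
  preserves {X Y} g hg := by
    rw [ModuleCat.epi_iff_surjective] at hg ⊢
    intro y
    obtain ⟨x, hx⟩ := Module.projective_lifting_property g.hom
      (ModuleCat.CoextendScalars.equiv f Y y) hg
    exact ⟨(ModuleCat.CoextendScalars.equiv f X).symm x,
      ModuleCat.CoextendScalars.ext hx⟩

theorem coextendScalars_preservesFiniteColimits
    [Module.Projective S ((ModuleCat.restrictScalars f).obj (ModuleCat.of T T))] :
    PreservesFiniteColimits (ModuleCat.coextendScalars.{u, u, u} f) := by
  have := coextendScalars_preservesEpimorphisms f
  have := (ModuleCat.restrictCoextendScalarsAdj.{u, u, u} f).isRightAdjoint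
  suffices PreservesFiniteLimits (ModuleCat.coextendScalars.{u, u, u} f) ∧
      PreservesFiniteColimits (ModuleCat.coextendScalars.{u, u, u} f) from this.2
  refine ((Functor.exact_tfae (ModuleCat.coextendScalars.{u, u, u} f)).out 0 3).mp
    fun K hK => ?_
  have := hK.epi_g
  have := hK.mono_f
  exact { exact := hK.exact.map_of_mono_of_preservesKernel _ inferInstance inferInstance
          mono_f := inferInstanceAs (Mono ((ModuleCat.coextendScalars.{u, u, u} f).map K.f))
          epi_g := inferInstanceAs (Epi ((ModuleCat.coextendScalars.{u, u, u} f).map K.g)) }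

theorem projective_restrictScalars
    [Module.Projective S ((ModuleCat.restrictScalars f).obj (ModuleCat.of T T))]
    (P : ModuleCat.{u} T) (hP : Projective P) :
    Projective ((ModuleCat.restrictScalars.{u} f).obj P) :=
  have := coextendScalars_preservesEpimorphisms f
  (ModuleCat.restrictCoextendScalarsAdj.{u, u, u} f).map_projective P hP

end ChangeOfRings

/-! ### Relative coinduction along a split extension of algebras -/

/-- An extension `φ : S → T` of `k`-algebras of the kind `E ⊗ U → Λ ⊗ U`, where `Λ = E ⊕ X` for an
`E`-bimodule `X` which is a direct summand of `X ⊗ₖ E`. The left and right actions of `E` on `X`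
are recorded as the families of endomorphisms `lact` and `ract`, so that the opposite of an
algebra `E` acting with sides interchanged is covered as well. -/
structure SplitExtension (k : Type u) [Field k] (E S T U X : Type u) [Ring E] [Algebra k E]
    [Ring S] [Algebra k S] [Ring T] [Algebra k T] [Ring U] [Algebra k U]
    [AddCommGroup X] [Module k X] where
  /-- The extension of algebras. -/
  φ : S →ₐ[k] T
  /-- The factor `U` of `S`. -/
  υ : U →ₐ[k] S
  /-- The factor `E` of `S`. -/
  ε : E →ₐ[k] S
  /-- The left action of `E` on `X`. -/
  lact : E → X →ₗ[k] X
  /-- The right action of `E` on `X`. -/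
  ract : E →ₗ[k] X →ₗ[k] X
  /-- The inclusion of `X`. -/
  j : X →ₗ[k] T
  /-- The splitting of the right action map `X ⊗ₖ E → X`. -/
  s : X →ₗ[k] X ⊗[k] E
  comm : ∀ e u, ε e * υ u = υ u * ε e
  generate : ∀ x : S, x ∈ AddSubmonoid.closure {x | ∃ e u, x = ε e * υ u}
  j_lact : ∀ e m, j (lact e m) = φ (ε e) * j m
  j_ract : ∀ e m, j (ract e m) = j m * φ (ε e)
  j_comm : ∀ u m, j m * φ (υ u) = φ (υ u) * j m
  s_lact : ∀ e m, s (lact e m) = (lact e).rTensor E (s m)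
  s_ract : ∀ e m, s (ract e m) = (LinearMap.mulRight k e).lTensor X (s m)
  ract_s : ∀ m, TensorProduct.lift ract.flip (s m) = m
  hom_ext : ∀ (Y : ModuleCat.{u} S)
    (f : (ModuleCat.restrictScalars φ.toRingHom).obj (ModuleCat.of T T) →ₗ[S] Y),
    f (1 : T) = 0 → (∀ m, f (j m) = 0) → f = 0
  exists_hom : ∀ (Y : ModuleCat.{u} S) (g : X →+ Y), (∀ e m, g (lact e m) = ε e • g m) →
    ∃ f : (ModuleCat.restrictScalars φ.toRingHom).obj (ModuleCat.of T T) →ₗ[S] Y,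
      f (1 : T) = 0 ∧ ∀ m, f (j m) = g m
  projective_top : Module.Projective S
    ((ModuleCat.restrictScalars φ.toRingHom).obj (ModuleCat.of T T))
  projective_mid : Module.Projective U
    ((ModuleCat.restrictScalars υ.toRingHom).obj (ModuleCat.of S S))

namespace SplitExtension

open ModuleCat Abelian

variable {k : Type u} [Field k] {E S T U X : Type u} [Ring E] [Algebra k E]
    [Ring S] [Algebra k S] [Ring T] [Algebra k T] [Ring U] [Algebra k U]
    [AddCommGroup X] [Module k X] (D : SplitExtension k E S T U X)

/-- Restriction of scalars along `S → T`. -/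
noncomputable abbrev res : ModuleCat.{u} T ⥤ ModuleCat.{u} S := restrictScalars D.φ.toRingHom

/-- Restriction of scalars along `U → S`. -/
noncomputable abbrev resU : ModuleCat.{u} S ⥤ ModuleCat.{u} U := restrictScalars D.υ.toRingHom

/-- The coinduced module `Hom_S(T, Y)`. -/
noncomputable abbrev coind (Y : ModuleCat.{u} T) : ModuleCat.{u} T :=
  (coextendScalars D.φ.toRingHom).obj (D.res.obj Y)

/-- The embedding `y ↦ (t ↦ t y)` of a module into the coinduced module. -/
noncomputable abbrev unit (Y : ModuleCat.{u} T) : Y ⟶ D.coind Y :=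
  (RestrictionCoextensionAdj.unit' D.φ.toRingHom).app Y

/-- The cokernel of the embedding of `Y` into its coinduced module. Its elements correspond to the
left `E`-linear maps `X → Y`, see `cosyzygyEval`. -/
noncomputable def cosyzygy (Y : ModuleCat.{u} T) : ModuleCat.{u} T :=
  ModuleCat.of T (D.coind Y ⧸ LinearMap.range (D.unit Y).hom)

/-- The projection of the coinduced module onto the cosyzygy. -/
noncomputable def toCosyzygy (Y : ModuleCat.{u} T) : D.coind Y ⟶ D.cosyzygy Y :=
  ModuleCat.ofHom (LinearMap.range (D.unit Y).hom).mkQ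

theorem toCosyzygy_surjective (Y : ModuleCat.{u} T) :
    Function.Surjective (D.toCosyzygy Y).hom :=
  Submodule.mkQ_surjective _

/-- The value at `t : T` of an element of `Hom_S(T, Y)`. -/
noncomputable def ev {Y : ModuleCat.{u} T} (f : D.coind Y) (t : T) : Y :=
  CoextendScalars.equiv D.φ.toRingHom (D.res.obj Y) f t

variable {D}

@[simp] theorem ev_add {Y : ModuleCat.{u} T} (f g : D.coind Y) (t : T) :
    D.ev (f + g) t = D.ev f t + D.ev g t := rfl

@[simp] theorem ev_zero {Y : ModuleCat.{u} T} (t : T) :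
    D.ev (0 : D.coind Y) t = 0 := rfl

@[simp] theorem ev_smul {Y : ModuleCat.{u} T} (t' : T) (f : D.coind Y) (t : T) :
    D.ev (t' • f) t = D.ev f (t * t') := rfl

@[simp] theorem ev_unit {Y : ModuleCat.{u} T} (y : Y) (t : T) :
    D.ev ((D.unit Y).hom y) t = t • y := rfl

theorem ev_map_add {Y : ModuleCat.{u} T} (f : D.coind Y) (t t' : T) :
    D.ev f (t + t') = D.ev f t + D.ev f t' :=
  map_add (CoextendScalars.equiv D.φ.toRingHom (D.res.obj Y) f) t t'

theorem ev_map_smul {Y : ModuleCat.{u} T} (f : D.coind Y) (s : S) (t : T) :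
    D.ev f (D.φ s * t) = D.φ s • D.ev f t :=
  (CoextendScalars.equiv D.φ.toRingHom (D.res.obj Y) f).map_smul s
    (show (restrictScalars D.φ.toRingHom).obj (ModuleCat.of T T) from t)

theorem ev_map_smul' {Y : ModuleCat.{u} T} (f : D.coind Y) (c : k) (t : T) :
    D.ev f (c • t) = c • D.ev f t := by
  have := ev_map_smul f (algebraMap k S c) t
  rw [AlgHom.commutes] at this
  rw [Algebra.smul_def, this]
  rfl

variable (D)

theorem unit_injective (Y : ModuleCat.{u} T) : Function.Injective (D.unit Y).hom := by
  intro x y h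
  have h' := congrArg (fun f => D.ev f 1) h
  simpa only [ev_unit, one_smul] using h'

/-- The short exact sequence `0 → Y → Hom_S(T, Y) → cosyzygy Y → 0`. -/
noncomputable abbrev seq (Y : ModuleCat.{u} T) : ShortComplex (ModuleCat.{u} T) :=
  ShortComplex.mk (D.unit Y) (D.toCosyzygy Y) (by
    ext y
    exact (Submodule.Quotient.mk_eq_zero _).2 ⟨y, rfl⟩)

theorem seq_shortExact (Y : ModuleCat.{u} T) : (D.seq Y).ShortExact where
  exact := by
    rw [ShortComplex.ShortExact.moduleCat_exact_iff_function_exact]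
    exact LinearMap.exact_map_mkQ_range (D.unit Y).hom
  mono_f := (ModuleCat.mono_iff_injective _).2 (D.unit_injective Y)
  epi_g := (ModuleCat.epi_iff_surjective _).2 (D.toCosyzygy_surjective Y)

/-- The map `f ↦ (m ↦ f m - m f 1)` from the coinduced module to linear maps on `X`, which factors
over the cosyzygy. -/
noncomputable def coindEval (Y : ModuleCat.{u} T) : D.coind Y →+ (X →ₗ[k] Y) where
  toFun f :=
    { toFun m := D.ev f (D.j m) - D.j m • D.ev f 1
      map_add' m m' := by rw [map_add, ev_map_add, add_smul]; abel
      map_smul' c m := by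
        rw [map_smul, ev_map_smul', smul_assoc, RingHom.id_apply, smul_sub] }
  map_zero' := by ext; simp
  map_add' f g := by
    ext m
    simp only [ev_add, smul_add, LinearMap.coe_mk, AddHom.coe_mk, LinearMap.add_apply]
    abel

theorem coindEval_apply {Y : ModuleCat.{u} T} (f : D.coind Y) (m : X) :
    D.coindEval Y f m = D.ev f (D.j m) - D.j m • D.ev f 1 := rfl

/-- An element of the cosyzygy of `Y` as a linear map from `X` to `Y`. -/
noncomputable def cosyzygyEval (Y : ModuleCat.{u} T) : D.cosyzygy Y →+ (X →ₗ[k] Y) :=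
  QuotientAddGroup.lift (LinearMap.range (D.unit Y).hom).toAddSubgroup (D.coindEval Y) (by
    rintro _ ⟨y, rfl⟩
    ext m
    rw [coindEval_apply, ev_unit, ev_unit, one_smul, sub_self, LinearMap.zero_apply])

variable {D}

theorem cosyzygyEval_toCosyzygy {Y : ModuleCat.{u} T} (f : D.coind Y) :
    D.cosyzygyEval Y ((D.toCosyzygy Y).hom f) = D.coindEval Y f := rfl

theorem cosyzygyEval_injective (Y : ModuleCat.{u} T) :
    Function.Injective (D.cosyzygyEval Y) := by
  rw [injective_iff_map_eq_zero]
  intro c hc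
  obtain ⟨f, rfl⟩ := D.toCosyzygy_surjective Y c
  rw [cosyzygyEval_toCosyzygy] at hc
  refine (Submodule.Quotient.mk_eq_zero _).2 ⟨D.ev f 1, ?_⟩
  have h := D.hom_ext (D.res.obj Y)
    (CoextendScalars.equiv D.φ.toRingHom (D.res.obj Y) (f - (D.unit Y).hom (D.ev f 1))) ?_ ?_
  · exact (sub_eq_zero.1
      ((CoextendScalars.equiv D.φ.toRingHom (D.res.obj Y)).map_eq_zero_iff.1 h)).symm
  · change D.ev f 1 - (1 : T) • D.ev f 1 = 0
    rw [one_smul, sub_self]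
  · exact fun m => LinearMap.congr_fun hc m

theorem exists_cosyzygyEval_eq {Y : ModuleCat.{u} T} (g : X →ₗ[k] Y)
    (hg : ∀ e m, g (D.lact e m) = D.φ (D.ε e) • g m) : ∃ c, D.cosyzygyEval Y c = g := by
  obtain ⟨f, hf1, hf⟩ := D.exists_hom (D.res.obj Y) g.toAddMonoidHom hg
  refine ⟨(D.toCosyzygy Y).hom ((CoextendScalars.equiv D.φ.toRingHom (D.res.obj Y)).symm f), ?_⟩
  rw [cosyzygyEval_toCosyzygy]
  ext m
  rw [coindEval_apply]
  have h1 : D.ev ((CoextendScalars.equiv D.φ.toRingHom (D.res.obj Y)).symm f) 1 = 0 := hf1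
  rw [h1, smul_zero, sub_zero]
  exact hf m

theorem cosyzygyEval_lact {Y : ModuleCat.{u} T} (c : D.cosyzygy Y) (e : E) (m : X) :
    D.cosyzygyEval Y c (D.lact e m) = D.φ (D.ε e) • D.cosyzygyEval Y c m := by
  obtain ⟨f, rfl⟩ := D.toCosyzygy_surjective Y c
  rw [cosyzygyEval_toCosyzygy, coindEval_apply, coindEval_apply, D.j_lact, ev_map_smul, smul_sub,
    mul_smul]

theorem cosyzygyEval_smul_E {Y : ModuleCat.{u} T} (c : D.cosyzygy Y) (e : E) (m : X) :
    D.cosyzygyEval Y (D.φ (D.ε e) • c) m = D.cosyzygyEval Y c (D.ract e m) := by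
  obtain ⟨f, rfl⟩ := D.toCosyzygy_surjective Y c
  rw [← map_smul, cosyzygyEval_toCosyzygy, cosyzygyEval_toCosyzygy, coindEval_apply,
    coindEval_apply, D.j_ract, ev_smul, ev_smul, mul_smul, one_mul]
  congr 2
  rw [← ev_map_smul, mul_one]

theorem cosyzygyEval_smul_U {Y : ModuleCat.{u} T} (c : D.cosyzygy Y) (x : U) (m : X) :
    D.cosyzygyEval Y (D.φ (D.υ x) • c) m = D.φ (D.υ x) • D.cosyzygyEval Y c m := by
  obtain ⟨f, rfl⟩ := D.toCosyzygy_surjective Y c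
  rw [← map_smul, cosyzygyEval_toCosyzygy, cosyzygyEval_toCosyzygy, coindEval_apply,
    coindEval_apply, ev_smul, ev_smul, one_mul, D.j_comm, ev_map_smul, smul_sub, ← mul_smul,
    ← D.j_comm, mul_smul]
  congr 2
  rw [← ev_map_smul, mul_one]

end SplitExtension

/-! ### Classes which vanish on restriction along a split extension -/

namespace SplitExtension

open ModuleCat Abelian Limits

variable {k : Type u} [Field k] {E S T U X : Type u} [Ring E] [Algebra k E]
    [Ring S] [Algebra k S] [Ring T] [Algebra k T] [Ring U] [Algebra k U]
    [AddCommGroup X] [Module k X] {D : SplitExtension k E S T U X}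

theorem cosyzygyEval_smul {Y : ModuleCat.{u} T} (a : k) (c : D.cosyzygy Y) (m : X) :
    D.cosyzygyEval Y (a • c) m = a • D.cosyzygyEval Y c m := by
  have h := cosyzygyEval_smul_U c (algebraMap k U a) m
  rw [AlgHom.commutes, AlgHom.commutes] at h
  exact h

/-- Evaluation of elements of the cosyzygy at elements of `X`, as a bilinear map. -/
noncomputable def cosyzygyEvalFlip (D : SplitExtension k E S T U X) (Y : ModuleCat.{u} T) :
    X →ₗ[k] D.cosyzygy Y →ₗ[k] Y :=
  LinearMap.mk₂ k (fun m c => D.cosyzygyEval Y c m)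
    (fun m m' c => map_add _ m m') (fun a m c => map_smul _ a m)
    (fun m c c' => by rw [map_add, LinearMap.add_apply])
    (fun a m c => cosyzygyEval_smul a c m)

/-- The cosyzygy is injective relative to `U`: it is a direct summand of the `S`-module coinduced
from its restriction to `U`. The retraction sends `ψ : S → cosyzygy Y` to the element which
takes the value `∑ ψ(a)(m')` at `m`, where `∑ m' ⊗ a` is the image of `m` under the splitting
`X → X ⊗ₖ E`. -/
theorem exists_retraction_cosyzygy (Y : ModuleCat.{u} T) :
    ∃ r : (coextendScalars D.υ.toRingHom).obj (D.resU.obj (D.res.obj (D.cosyzygy Y))) ⟶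
        D.res.obj (D.cosyzygy Y),
      (RestrictionCoextensionAdj.unit' D.υ.toRingHom).app (D.res.obj (D.cosyzygy Y)) ≫ r = 𝟙 _ := by
  let C := D.cosyzygy Y
  let K := (coextendScalars D.υ.toRingHom).obj (D.resU.obj (D.res.obj C))
  let val : K → S → C := fun ψ x => CoextendScalars.equiv D.υ.toRingHom _ ψ x
  have val_add (ψ : K) (x y : S) : val ψ (x + y) = val ψ x + val ψ y :=
    map_add (CoextendScalars.equiv D.υ.toRingHom _ ψ) x y
  have val_mul (ψ : K) (a : U) (x : S) : val ψ (D.υ a * x) = D.φ (D.υ a) • val ψ x :=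
    (CoextendScalars.equiv D.υ.toRingHom _ ψ).map_smul a
      (show (restrictScalars D.υ.toRingHom).obj (ModuleCat.of S S) from x)
  have val_smulk (ψ : K) (a : k) (x : S) : val ψ (a • x) = a • val ψ x := by
    rw [Algebra.smul_def, ← AlgHom.commutes D.υ, val_mul, AlgHom.commutes, AlgHom.commutes]
    rfl
  let pair (ψ : K) : X ⊗[k] E →ₗ[k] Y := TensorProduct.lift <|
    LinearMap.mk₂ k (fun m a => D.cosyzygyEval Y (val ψ (D.ε a)) m)
      (fun m m' a => map_add _ m m') (fun c m a => map_smul _ c m)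
      (fun m a a' => by rw [map_add, val_add, map_add, LinearMap.add_apply])
      (fun c m a => by rw [map_smul, val_smulk, cosyzygyEval_smul])
  have pair_tmul (ψ : K) (m : X) (a : E) :
    pair ψ (m ⊗ₜ a) = D.cosyzygyEval Y (val ψ (D.ε a)) m := rfl
  have hex (ψ : K) : ∃ c : C, D.cosyzygyEval Y c = pair ψ ∘ₗ D.s := by
    refine exists_cosyzygyEval_eq _ fun e m => ?_
    rw [LinearMap.comp_apply, LinearMap.comp_apply, D.s_lact]
    induction D.s m with
    | zero => simp
    | tmul m a => rw [LinearMap.rTensor_tmul, pair_tmul, pair_tmul, cosyzygyEval_lact]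
    | add x y hx hy => rw [map_add, map_add, hx, hy, map_add, smul_add]
  choose r hr using hex
  have r_add (ψ ψ' : K) : r (ψ + ψ') = r ψ + r ψ' := by
    apply cosyzygyEval_injective Y
    rw [map_add, hr, hr, hr, ← LinearMap.add_comp]
    congr 1
    ext m a
    change D.cosyzygyEval Y (val ψ _ + val ψ' _) m = _
    rw [map_add]
    rfl
  have r_E (e : E) (ψ : K) : r (D.ε e • ψ) = D.φ (D.ε e) • r ψ := by
    apply cosyzygyEval_injective Y
    ext m
    rw [cosyzygyEval_smul_E, hr, hr, LinearMap.comp_apply, LinearMap.comp_apply, D.s_ract]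
    induction D.s m with
    | zero => simp
    | tmul m a =>
      rw [LinearMap.lTensor_tmul, pair_tmul, pair_tmul, LinearMap.mulRight_apply, map_mul]
      rfl
    | add x y hx hy => rw [map_add, map_add, hx, hy, map_add]
  have r_U (a : U) (ψ : K) : r (D.υ a • ψ) = D.φ (D.υ a) • r ψ := by
    apply cosyzygyEval_injective Y
    ext m
    rw [cosyzygyEval_smul_U, hr, hr, LinearMap.comp_apply, LinearMap.comp_apply]
    induction D.s m with
    | zero => simp
    | tmul m b =>
      rw [pair_tmul, pair_tmul, ← cosyzygyEval_smul_U, ← val_mul, ← D.comm]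
      rfl
    | add x y hx hy => rw [map_add, map_add, hx, hy, smul_add]
  have r_S (x : S) (ψ : K) : r (x • ψ) = D.φ x • r ψ := by
    induction D.generate x using AddSubmonoid.closure_induction with
    | mem x hx =>
      obtain ⟨e, a, rfl⟩ := hx
      rw [mul_smul, r_E, r_U, map_mul, mul_smul]
    | zero =>
      have h0 : r 0 = 0 := by simpa using r_add 0 0
      rw [zero_smul, map_zero, zero_smul, h0]
    | add x y _ _ hx hy => rw [add_smul, r_add, hx, hy, map_add, add_smul]
  refine ⟨ModuleCat.ofHom (Y := D.res.obj C)
    { toFun := r, map_add' := r_add, map_smul' := r_S }, ?_⟩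
  ext c
  apply cosyzygyEval_injective Y
  refine (hr _).trans ?_
  ext m
  rw [LinearMap.comp_apply]
  refine Eq.trans ?_ (congrArg (D.cosyzygyEval Y c) (D.ract_s m))
  induction D.s m with
  | zero => simp
  | tmul m a => exact cosyzygyEval_smul_E c a m
  | add x y hx hy => rw [map_add, map_add, hx, hy, map_add]

/-- Cosyzygies have no higher extensions over `S` with modules which are projective over `U`. -/
theorem ext_cosyzygy_eq_zero (Y : ModuleCat.{u} T) {Q : ModuleCat.{u} S}
    (hQ : Projective (D.resU.obj Q)) {n : ℕ}
    (x : Ext Q (D.res.obj (D.cosyzygy Y)) (n + 1)) : x = 0 := by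
  obtain ⟨r, hr⟩ := exists_retraction_cosyzygy (D := D) Y
  have := D.projective_mid
  have := coextendScalars_preservesFiniteColimits D.υ.toRingHom
  have := (restrictCoextendScalarsAdj.{u, u, u} D.υ.toRingHom).isRightAdjoint
  have h := comp_unit_eq_zero_of_mapExactFunctor_eq_zero
    (RestrictionCoextensionAdj.unit' D.υ.toRingHom) x (Ext.eq_zero_of_projective _)
  have h' := congrArg (fun z => z.comp (Ext.mk₀ r) (add_zero _)) h
  simp only [Ext.zero_comp] at h'
  rw [Ext.comp_assoc _ _ _ _ (add_zero 0) (by lia), Ext.mk₀_comp_mk₀, hr] at h'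
  simpa using h'

/-- A class which vanishes over `S` comes from the cosyzygy. -/
theorem exists_comp_extClass_of_res_eq_zero {Z Y : ModuleCat.{u} T} {n : ℕ}
    (x : Ext Z Y (n + 1)) (hx : x.mapExactFunctor D.res = 0) :
    ∃ y : Ext Z (D.cosyzygy Y) n, y.comp (D.seq_shortExact Y).extClass rfl = x := by
  have := D.projective_top
  have := coextendScalars_preservesFiniteColimits D.φ.toRingHom
  have := (restrictCoextendScalarsAdj.{u, u, u} D.φ.toRingHom).isRightAdjoint
  exact Ext.covariant_sequence_exact₁ Z (D.seq_shortExact Y) x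
    (comp_unit_eq_zero_of_mapExactFunctor_eq_zero
      (RestrictionCoextensionAdj.unit' D.φ.toRingHom) x hx) rfl

theorem ext_cosyzygy_eq_zero_of_subsingleton {Z : ModuleCat.{u} T}
    (hZ : Projective (D.resU.obj (D.res.obj Z))) (i : ℕ) :
    ∀ (n : ℕ) (Y : ModuleCat.{u} T), Subsingleton (D.cosyzygy^[i] (D.cosyzygy Y)) → i ≤ n →
      ∀ x : Ext Z (D.cosyzygy Y) n, x = 0 := by
  induction i with
  | zero =>
    intro n Y hY _ x
    have h0 : 𝟙 (D.cosyzygy Y) = 0 := by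
      ext y
      exact hY.elim _ _
    rw [← Ext.comp_mk₀_id x, h0, Ext.mk₀_zero, Ext.comp_zero]
  | succ i ih =>
    intro n Y hY hn x
    obtain ⟨n, rfl⟩ := Nat.exists_eq_add_of_le' (Nat.one_le_of_lt hn)
    obtain ⟨y, rfl⟩ := exists_comp_extClass_of_res_eq_zero (D := D) x
      (ext_cosyzygy_eq_zero Y hZ _)
    rw [ih n (D.cosyzygy Y) hY (by lia) y, Ext.zero_comp]

/-- Let `Z` be projective over `U`. If the `h`-th cosyzygy of `Y` vanishes, then a class in
`Ext^n(Z, Y)` with `n ≥ h` is determined by its restriction to `S`. -/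
theorem eq_zero_of_res_eq_zero_of_subsingleton {Z : ModuleCat.{u} T}
    (hZ : Projective (D.resU.obj (D.res.obj Z))) {h : ℕ} (h0 : 0 < h) {Y : ModuleCat.{u} T}
    (hY : Subsingleton (D.cosyzygy^[h] Y)) {n : ℕ} (hn : h ≤ n) (x : Ext Z Y n)
    (hx : x.mapExactFunctor D.res = 0) : x = 0 := by
  obtain ⟨h, rfl⟩ := Nat.exists_eq_add_of_le' h0
  obtain ⟨n, rfl⟩ := Nat.exists_eq_add_of_le' (Nat.one_le_of_lt hn)
  obtain ⟨y, rfl⟩ := exists_comp_extClass_of_res_eq_zero (D := D) x hx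
  rw [ext_cosyzygy_eq_zero_of_subsingleton hZ h n Y hY (by lia) y, Ext.zero_comp]

/-- A criterion for the injectivity, in positive degrees, of the composite of
restriction to `S` and of the pull-back along a morphism `i : Q ⟶ Z` of `S`-modules. -/
theorem eq_zero_of_comp_res_eq_zero {Z : ModuleCat.{u} T} {Q : ModuleCat.{u} S}
    (i : Q ⟶ D.res.obj Z) (hQ : Projective (D.resU.obj Q))
    (hi : ∀ (n : ℕ) (W : ModuleCat.{u} S) (z : Ext (D.res.obj Z) W (n + 1)),
      (Ext.mk₀ i).comp z (zero_add _) = 0 → z = 0)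
    (hlift : ∀ (Y : ModuleCat.{u} T) (g : Z ⟶ D.cosyzygy Y), ∃ g', g' ≫ D.toCosyzygy Y = g)
    (n : ℕ) (Y : ModuleCat.{u} T) (x : Ext Z Y (n + 1))
    (hx : (Ext.mk₀ i).comp (x.mapExactFunctor D.res) (zero_add _) = 0) : x = 0 := by
  induction n generalizing Y with
  | zero =>
    obtain ⟨y, rfl⟩ := exists_comp_extClass_of_res_eq_zero (D := D) x (hi _ _ _ hx)
    obtain ⟨g, rfl⟩ := (Ext.mk₀_bijective _ _).2 y
    obtain ⟨g', rfl⟩ := hlift Y g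
    rw [← Ext.mk₀_comp_mk₀, Ext.comp_assoc _ _ _ _ (zero_add 1) (by lia)]
    have := (D.seq_shortExact Y).comp_extClass
    dsimp only at this
    rw [this, Ext.comp_zero]
  | succ n ih =>
    obtain ⟨y, rfl⟩ := exists_comp_extClass_of_res_eq_zero (D := D) x (hi _ _ _ hx)
    rw [ih (D.cosyzygy Y) y (ext_cosyzygy_eq_zero Y hQ _), Ext.zero_comp]

/-- An element of the `h`-th cosyzygy of `Y` as a multilinear map from `X ^ h` to `Y`. -/
noncomputable def cosyzygyMultilinear (D : SplitExtension k E S T U X) :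
    (h : ℕ) → (Y : ModuleCat.{u} T) → ((D.cosyzygy^[h] Y : ModuleCat.{u} T)) →
      MultilinearMap k (fun _ : Fin h => X) Y
  | 0, Y, c => MultilinearMap.constOfIsEmpty k (fun _ : Fin 0 => X) (show Y from c)
  | h + 1, Y, c => LinearMap.uncurryLeft
      { toFun := fun m => (D.cosyzygyEvalFlip Y m).compMultilinearMap
          (cosyzygyMultilinear D h (D.cosyzygy Y) c)
        map_add' := fun m m' => by ext; simp
        map_smul' := fun a m => by ext; simp }

theorem cosyzygyMultilinear_succ {h : ℕ} {Y : ModuleCat.{u} T}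
    (c : (D.cosyzygy^[h + 1] Y : ModuleCat.{u} T)) (x : Fin (h + 1) → X) :
    D.cosyzygyMultilinear (h + 1) Y c x =
      D.cosyzygyEval Y (D.cosyzygyMultilinear h (D.cosyzygy Y) c (Fin.tail x)) (x 0) := rfl

theorem eq_zero_of_cosyzygyMultilinear_eq_zero {h : ℕ} {Y : ModuleCat.{u} T}
    (c : (D.cosyzygy^[h] Y : ModuleCat.{u} T)) (hc : D.cosyzygyMultilinear h Y c = 0) :
    c = 0 := by
  induction h generalizing Y with
  | zero => exact congrArg (fun f => f ![]) hc
  | succ h ih =>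
    refine ih (Y := D.cosyzygy Y) c (MultilinearMap.ext fun x => ?_)
    apply cosyzygyEval_injective Y
    ext m
    have := DFunLike.congr_fun hc (Fin.cons m x)
    rw [cosyzygyMultilinear_succ, Fin.tail_cons, Fin.cons_zero] at this
    rw [this]
    simp

theorem cosyzygyMultilinear_update_zero {h : ℕ} {Y : ModuleCat.{u} T}
    (c : (D.cosyzygy^[h + 1] Y : ModuleCat.{u} T)) (x : Fin (h + 1) → X) (e : E) :
    D.cosyzygyMultilinear (h + 1) Y c (Function.update x 0 (D.lact e (x 0))) =
      D.φ (D.ε e) • D.cosyzygyMultilinear (h + 1) Y c x := by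
  rw [cosyzygyMultilinear_succ, cosyzygyMultilinear_succ, Fin.tail_update_zero,
    Function.update_self, cosyzygyEval_lact]

theorem cosyzygyMultilinear_balanced {h : ℕ} {Y : ModuleCat.{u} T}
    (c : (D.cosyzygy^[h] Y : ModuleCat.{u} T)) (x : Fin h → X) (e : E) (i j : Fin h)
    (hij : (i : ℕ) + 1 = j) :
    D.cosyzygyMultilinear h Y c (Function.update x i (D.ract e (x i))) =
      D.cosyzygyMultilinear h Y c (Function.update x j (D.lact e (x j))) := by
  induction h generalizing Y with
  | zero => exact i.elim0
  | succ h ih =>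
    obtain ⟨j, rfl⟩ := Fin.exists_succ_eq.2 (show j ≠ 0 by rintro rfl; simp at hij)
    rw [cosyzygyMultilinear_succ, cosyzygyMultilinear_succ, Fin.tail_update_succ,
      Function.update_of_ne (Fin.succ_ne_zero j).symm]
    induction i using Fin.cases with
    | zero =>
      rw [Fin.tail_update_zero, Function.update_self, ← cosyzygyEval_smul_E]
      obtain ⟨h, rfl⟩ : ∃ h', h = h' + 1 := ⟨h - 1, by have := j.2; lia⟩
      obtain rfl : j = 0 := by ext; simpa using hij.symm
      exact (congrArg (fun z => D.cosyzygyEval Y z (x 0))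
        (cosyzygyMultilinear_update_zero (Y := D.cosyzygy Y) c (Fin.tail x) e)).symm
    | succ i =>
      rw [Fin.tail_update_succ, Function.update_of_ne (Fin.succ_ne_zero i).symm]
      congr 2
      exact ih (Y := D.cosyzygy Y) c (Fin.tail x) i j (by simpa using hij)

/-- The `h`-th cosyzygies vanish when every balanced multilinear map on `X ^ h` does. -/
theorem subsingleton_iterate_cosyzygy {h : ℕ} (Y : ModuleCat.{u} T)
    (hX : ∀ f : MultilinearMap k (fun _ : Fin h => X) Y,
      (∀ (x : Fin h → X) (e : E) (i j : Fin h), (i : ℕ) + 1 = j →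
        f (Function.update x i (D.ract e (x i))) = f (Function.update x j (D.lact e (x j)))) →
      f = 0) :
    Subsingleton (D.cosyzygy^[h] Y : ModuleCat.{u} T) :=
  subsingleton_of_forall_eq 0 fun c =>
    eq_zero_of_cosyzygyMultilinear_eq_zero c (hX _ (cosyzygyMultilinear_balanced c))

end SplitExtension

/-! ### Extensions of the form `E ⊗ U → Λ ⊗ U` -/

/-- A morphism `φ : S → T` of algebras which is isomorphic to `ι ⊗ U : E ⊗ U → Λ ⊗ U`, up to the
order of the tensor factors; `S` is only required to be generated by the images of `E` and `U`. -/
structure TensorExtension (k : Type u) [Field k] (E L U S T : Type u) [Ring E] [Algebra k E]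
    [Ring L] [Algebra k L] [Ring U] [Algebra k U] [Ring S] [Algebra k S] [Ring T] [Algebra k T]
    (ι : E →ₐ[k] L) where
  /-- The morphism of algebras. -/
  φ : S →ₐ[k] T
  /-- The factor `E` of `S`. -/
  ε : E →ₐ[k] S
  /-- The factor `U` of `S`. -/
  υ : U →ₐ[k] S
  /-- The factor `Λ` of `T`. -/
  a : L →ₐ[k] T
  φ_ε : ∀ e, φ (ε e) = a (ι e)
  comm : ∀ e u, ε e * υ u = υ u * ε e
  comm' : ∀ x u, a x * φ (υ u) = φ (υ u) * a x
  generate : ∀ x : S, x ∈ AddSubmonoid.closure {x | ∃ e u, x = ε e * υ u}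
  bijective : Function.Bijective
    (TensorProduct.lift ((LinearMap.mul k T).compl₁₂ a.toLinearMap (φ.comp υ).toLinearMap))

namespace TensorExtension

open ModuleCat

variable {k : Type u} [Field k] {E L U S T : Type u} [Ring E] [Algebra k E]
    [Ring L] [Algebra k L] [Ring U] [Algebra k U] [Ring S] [Algebra k S] [Ring T] [Algebra k T]
    {ι : E →ₐ[k] L} (D : TensorExtension k E L U S T ι)

theorem mem_closure_mul (t : T) :
    t ∈ AddSubmonoid.closure {t | ∃ x u, t = D.φ (D.υ u) * D.a x} := by
  obtain ⟨z, rfl⟩ := D.bijective.2 t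
  induction z with
  | zero => rw [map_zero]; exact zero_mem _
  | tmul x u => exact AddSubmonoid.subset_closure ⟨x, u, D.comm' x u⟩
  | add x y hx hy => rw [map_add]; exact add_mem hx hy

/-- An `S`-linear map on `T` is determined by its values on `Λ`. -/
theorem hom_ext (Y : ModuleCat.{u} S)
    (f : (restrictScalars D.φ.toRingHom).obj (ModuleCat.of T T) →ₗ[S] Y)
    (hf : ∀ x, f (D.a x) = 0) : f = 0 := by
  have key (t : T) : f t = 0 := by
    induction D.mem_closure_mul t using AddSubmonoid.closure_induction with
    | mem t ht =>
      obtain ⟨x, u, rfl⟩ := ht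
      refine (f.map_smul (D.υ u)
        (show (restrictScalars D.φ.toRingHom).obj (ModuleCat.of T T) from D.a x)).trans ?_
      rw [hf, smul_zero]
    | zero => exact map_zero f
    | add x y _ _ hx hy => exact (map_add f _ _).trans (by rw [hx, hy, add_zero])
  exact LinearMap.ext key

/-- An `E`-linear map on `Λ` extends to an `S`-linear map on `T`. -/
theorem exists_hom (Y : ModuleCat.{u} S) (g : L →+ Y)
    (hg : ∀ e x, g (ι e * x) = D.ε e • g x) :
    ∃ f : (restrictScalars D.φ.toRingHom).obj (ModuleCat.of T T) →ₗ[S] Y,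
      ∀ x, f (D.a x) = g x := by
  have hgk (c : k) (x : L) : g (c • x) = algebraMap k S c • g x := by
    rw [Algebra.smul_def, ← AlgHom.commutes ι, hg, AlgHom.commutes]
  let F : L ⊗[k] U →+ Y := TensorProduct.liftAddHom
    (AddMonoidHom.mk' (fun x => AddMonoidHom.mk' (fun u => D.υ u • g x)
      (fun u u' => by rw [map_add, add_smul]))
      (fun x x' => by ext u; simp))
    (fun c x u => by
      change D.υ u • g (c • x) = D.υ (c • u) • g x
      rw [hgk, ← mul_smul, map_smul, Algebra.smul_def, Algebra.commutes])
  let τ := (LinearEquiv.ofBijective _ D.bijective).symm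
  have hτ (x : L) (u : U) : F (τ (D.φ (D.υ u) * D.a x)) = D.υ u • g x := by
    have h : τ (D.φ (D.υ u) * D.a x) = x ⊗ₜ u := by
      rw [LinearEquiv.symm_apply_eq, ← D.comm']
      rfl
    rw [h]
    rfl
  have hsmul (s : S) (t : T) : F (τ (D.φ s * t)) = s • F (τ t) := by
    induction D.mem_closure_mul t using AddSubmonoid.closure_induction with
    | zero => simp
    | add x y _ _ hx hy => rw [mul_add, map_add, map_add, map_add, map_add, hx, hy, smul_add]
    | mem t ht =>
      obtain ⟨x, u, rfl⟩ := ht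
      induction D.generate s using AddSubmonoid.closure_induction with
      | zero => simp
      | add r s _ _ hr hs => rw [map_add, add_mul, map_add, map_add, hr, hs, add_smul]
      | mem s hs =>
        obtain ⟨e, u', rfl⟩ := hs
        have h : D.φ (D.ε e * D.υ u') * (D.φ (D.υ u) * D.a x) =
            D.φ (D.υ (u' * u)) * D.a (ι e * x) := by
          rw [D.comm, map_mul, map_mul D.υ, map_mul D.φ, map_mul D.a, D.φ_ε, mul_assoc, mul_assoc,
            ← mul_assoc (D.a (ι e)), D.comm', mul_assoc]
        rw [h, hτ, hτ, hg, ← mul_smul, ← mul_smul, ← D.comm, map_mul, mul_assoc]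
  refine ⟨{ toFun t := F (τ t)
            map_add' x y := (congrArg F (map_add τ _ _)).trans (map_add F _ _)
            map_smul' := hsmul }, fun x => ?_⟩
  have h := hτ x 1
  rw [map_one, map_one, one_mul, one_smul] at h
  exact h

/-- If `Λ` is projective over `E`, then `T` is projective over `S`. -/
theorem projective
    (h : Module.Projective E ((restrictScalars ι.toRingHom).obj (ModuleCat.of L L))) :
    Module.Projective S ((restrictScalars D.φ.toRingHom).obj (ModuleCat.of T T)) := by
  refine Module.Projective.of_lifting_property'' fun f hf => ?_
  let P := (restrictScalars D.φ.toRingHom).obj (ModuleCat.of T T)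
  let F := ModuleCat.of S (P →₀ S)
  let q : (restrictScalars D.ε.toRingHom).obj F →ₗ[E] (restrictScalars D.ε.toRingHom).obj P :=
    { toFun := f
      map_add' := map_add f
      map_smul' e x := f.map_smul (D.ε e) x }
  let i : (restrictScalars ι.toRingHom).obj (ModuleCat.of L L) →ₗ[E]
      (restrictScalars D.ε.toRingHom).obj P :=
    { toFun x := D.a x
      map_add' x y := map_add D.a x y
      map_smul' e x := (map_mul D.a (ι e) x).trans (congrArg (· * D.a x) (D.φ_ε e).symm) }
  obtain ⟨g, hg⟩ := Module.projective_lifting_property q i hf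
  obtain ⟨s, hs⟩ := D.exists_hom F g.toAddMonoidHom (fun e x => g.map_smul e x)
  refine ⟨s, ?_⟩
  have h0 : f ∘ₗ s - LinearMap.id = 0 := by
    refine D.hom_ext P _ fun x => ?_
    exact sub_eq_zero.2 ((congrArg f (hs x)).trans (LinearMap.congr_fun hg x))
  exact sub_eq_zero.1 h0

end TensorExtension

/-- The tensor product `S` of two algebras `E` and `U` over a field is projective over `U`. -/
theorem projective_of_tensor_bijective {k : Type u} [Field k] {E U S : Type u} [Ring E]
    [Algebra k E] [Ring U] [Algebra k U] [Ring S] [Algebra k S] (ε : E →ₐ[k] S) (υ : U →ₐ[k] S)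
    (comm : ∀ e u, ε e * υ u = υ u * ε e)
    (bijective : Function.Bijective
      (TensorProduct.lift ((LinearMap.mul k S).compl₁₂ ε.toLinearMap υ.toLinearMap))) :
    Module.Projective U ((ModuleCat.restrictScalars υ.toRingHom).obj (ModuleCat.of S S)) := by
  let D : TensorExtension k k E U U S (Algebra.ofId k E) :=
    { φ := υ
      ε := Algebra.ofId k U
      υ := AlgHom.id k U
      a := ε
      φ_ε e := by simp [Algebra.ofId_apply]
      comm e u := Algebra.commutes e u
      comm' := comm
      generate x := AddSubmonoid.subset_closure ⟨1, x, by simp⟩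
      bijective := bijective }
  refine D.projective ?_
  have : Module.Projective k E := inferInstance
  let e : E ≃ₗ[k] (ModuleCat.restrictScalars (Algebra.ofId k E).toRingHom).obj
      (ModuleCat.of E E) :=
    { toFun := fun x => x
      map_add' := fun _ _ => rfl
      map_smul' := fun c x => Algebra.smul_def c x
      invFun := fun x => x
      left_inv := fun _ => rfl
      right_inv := fun _ => rfl }
  exact Module.Projective.of_equiv e

/-- A split extension `E → Λ` with complement `X`, where `X` is an `E`-bimodule (with actions `lact`
and `ract`) which is a direct summand of `X ⊗ₖ E`, and `Λ` is projective over `E`. -/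
structure OneSidedExtension (k : Type u) [Field k] (E L X : Type u) [Ring E] [Algebra k E]
    [Ring L] [Algebra k L] [AddCommGroup X] [Module k X] where
  /-- The inclusion of the subalgebra. -/
  ι : E →ₐ[k] L
  /-- The projection onto the subalgebra. -/
  π : L →ₗ[k] E
  /-- The inclusion of the complement. -/
  j : X →ₗ[k] L
  /-- The projection onto the complement. -/
  ρ : L →ₗ[k] X
  /-- The left action of `E` on `X`. -/
  lact : E → X →ₗ[k] X
  /-- The right action of `E` on `X`. -/
  ract : E →ₗ[k] X →ₗ[k] X
  /-- The splitting of the right action map `X ⊗ₖ E → X`. -/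
  s : X →ₗ[k] X ⊗[k] E
  decomp : ∀ x, ι (π x) + j (ρ x) = x
  ρ_one : ρ 1 = 0
  ρ_j : ∀ m, ρ (j m) = m
  ρ_mul : ∀ e x, ρ (ι e * x) = lact e (ρ x)
  j_lact : ∀ e m, j (lact e m) = ι e * j m
  j_ract : ∀ e m, j (ract e m) = j m * ι e
  s_lact : ∀ e m, s (lact e m) = (lact e).rTensor E (s m)
  s_ract : ∀ e m, s (ract e m) = (LinearMap.mulRight k e).lTensor X (s m)
  ract_s : ∀ m, TensorProduct.lift ract.flip (s m) = m
  projective : Module.Projective E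
    ((ModuleCat.restrictScalars ι.toRingHom).obj (ModuleCat.of L L))

/-- The extension `E ⊗ U → Λ ⊗ U` obtained from a split extension `E → Λ`. -/
noncomputable def OneSidedExtension.splitExtension {k : Type u} [Field k] {E L X U S T : Type u}
    [Ring E] [Algebra k E] [Ring L] [Algebra k L] [AddCommGroup X] [Module k X]
    [Ring U] [Algebra k U] [Ring S] [Algebra k S] [Ring T] [Algebra k T]
    (D : OneSidedExtension k E L X) (Q : TensorExtension k E L U S T D.ι)
    (hQ : Function.Bijective
      (TensorProduct.lift ((LinearMap.mul k S).compl₁₂ Q.ε.toLinearMap Q.υ.toLinearMap))) :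
    SplitExtension k E S T U X where
  φ := Q.φ
  υ := Q.υ
  ε := Q.ε
  lact := D.lact
  ract := D.ract
  j := Q.a.toLinearMap ∘ₗ D.j
  s := D.s
  comm := Q.comm
  generate := Q.generate
  j_lact e m := by
    simp only [LinearMap.comp_apply, AlgHom.toLinearMap_apply]
    rw [D.j_lact, map_mul, Q.φ_ε]
  j_ract e m := by
    simp only [LinearMap.comp_apply, AlgHom.toLinearMap_apply]
    rw [D.j_ract, map_mul, Q.φ_ε]
  j_comm u m := Q.comm' _ _
  s_lact := D.s_lact
  s_ract := D.s_ract
  ract_s := D.ract_s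
  hom_ext Y f h1 hj := by
    refine Q.hom_ext Y f fun x => ?_
    rw [← D.decomp x, map_add]
    refine (map_add f _ _).trans ?_
    rw [show f (Q.a (D.j (D.ρ x))) = 0 from hj _, add_zero, ← Q.φ_ε]
    have h := f.map_smul (Q.ε (D.π x))
      (show (ModuleCat.restrictScalars Q.φ.toRingHom).obj (ModuleCat.of T T) from (1 : T))
    rw [h1, smul_zero] at h
    refine Eq.trans (congrArg f ?_) h
    exact (mul_one (Q.φ (Q.ε (D.π x)))).symm
  exists_hom Y g hg := by
    obtain ⟨f, hf⟩ := Q.exists_hom Y (g.comp D.ρ.toAddMonoidHom) (fun e x => by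
      change g (D.ρ (D.ι e * x)) = _
      rw [D.ρ_mul, hg]
      rfl)
    refine ⟨f, ?_, fun m => ?_⟩
    · rw [← map_one Q.a, hf]
      change g (D.ρ 1) = 0
      rw [D.ρ_one, map_zero]
    · refine (hf (D.j m)).trans ?_
      change g (D.ρ (D.j m)) = _
      rw [D.ρ_j]
  projective_top := Q.projective D.projective
  projective_mid := projective_of_tensor_bijective Q.ε Q.υ Q.comm hQ

/-! ### Projective bimodules -/

section BimoduleSections

variable (k : Type u) [Field k] (E M : Type u) [Ring E] [Algebra k E] [AddCommGroup M]
  [Module k M] [Module E M] [Module Eᵐᵒᵖ M] [SMulCommClass E Eᵐᵒᵖ M] [IsScalarTower k E M]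
  [IsScalarTower k Eᵐᵒᵖ M]

/-- An `E`-bimodule as a module over the enveloping algebra. -/
noncomputable def bimoduleCat : ModuleCat.{u} (E ⊗[k] Eᵐᵒᵖ) :=
  letI : Module (E ⊗[k] Eᵐᵒᵖ) M := TensorProduct.Algebra.module
  ModuleCat.of (E ⊗[k] Eᵐᵒᵖ) M

/-- The underlying additive group of `bimoduleCat` is `M`. -/
def bimoduleCat.of : M ≃+ bimoduleCat k E M := AddEquiv.refl M

variable {k E M}

theorem bimoduleCat.tmul_smul (a : E) (b : Eᵐᵒᵖ) (m : M) :
    (a ⊗ₜ[k] b) • of k E M m = of k E M (a • b • m) :=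
  TensorProduct.Algebra.smul_def a b m

/-- The left action of an algebra on a bimodule. -/
noncomputable def leftAction (k E M : Type u) [Field k] [Ring E] [Algebra k E] [AddCommGroup M]
    [Module k M] [Module E M] [IsScalarTower k E M] : E →ₗ[k] M →ₗ[k] M :=
  (Algebra.lsmul k k M).toLinearMap

/-- The right action of an algebra on a bimodule. -/
noncomputable def rightAction (k E M : Type u) [Field k] [Ring E] [Algebra k E] [AddCommGroup M]
    [Module k M] [Module Eᵐᵒᵖ M] [IsScalarTower k Eᵐᵒᵖ M] : E →ₗ[k] M →ₗ[k] M :=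
  (Algebra.lsmul k k M).toLinearMap ∘ₗ (opLinearEquiv k : E ≃ₗ[k] Eᵐᵒᵖ).toLinearMap

@[simp] theorem leftAction_apply {k E M : Type u} [Field k] [Ring E] [Algebra k E]
    [AddCommGroup M] [Module k M] [Module E M] [IsScalarTower k E M] (e : E) (m : M) :
    leftAction k E M e m = e • m := rfl

@[simp] theorem rightAction_apply {k E M : Type u} [Field k] [Ring E] [Algebra k E]
    [AddCommGroup M] [Module k M] [Module Eᵐᵒᵖ M] [IsScalarTower k Eᵐᵒᵖ M] (e : E) (m : M) :
    rightAction k E M e m = op e • m := rfl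

/-- A projective bimodule is a direct summand of a free one; the section of the
presentation by the free bimodule on the set `M` is recorded here. -/
theorem IsProjectiveBimodule.exists_section (h : IsProjectiveBimodule k E E M) :
    ∃ σ : M →ₗ[k] (M →₀ E ⊗[k] Eᵐᵒᵖ),
      (∀ (e : E) m, σ (e • m) = (e ⊗ₜ[k] (1 : Eᵐᵒᵖ)) • σ m) ∧
      (∀ (e : E) m, σ (op e • m) = ((1 : E) ⊗ₜ[k] op e) • σ m) ∧
      ∀ m, Finsupp.linearCombination (E ⊗[k] Eᵐᵒᵖ) (bimoduleCat.of k E M) (σ m) =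
        bimoduleCat.of k E M m := by
  have h' : Module.Projective (E ⊗[k] Eᵐᵒᵖ) (bimoduleCat k E M) := h
  obtain ⟨s, hs⟩ := Module.projective_def.1 h'
  let s' : bimoduleCat k E M →ₗ[E ⊗[k] Eᵐᵒᵖ] (M →₀ E ⊗[k] Eᵐᵒᵖ) := s
  have h1 (e : E) (m : M) : s' (bimoduleCat.of k E M (e • m)) =
      (e ⊗ₜ[k] (1 : Eᵐᵒᵖ)) • s' (bimoduleCat.of k E M m) := by
    rw [← map_smul, bimoduleCat.tmul_smul, one_smul]
  refine ⟨{ toFun := fun m => s' (bimoduleCat.of k E M m)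
            map_add' := fun m m' => by rw [map_add, map_add]
            map_smul' := fun c m => ?_ }, h1, fun e m => ?_, hs⟩
  · rw [← algebraMap_smul E c m, h1, RingHom.id_apply, Algebra.algebraMap_eq_smul_one,
      ← TensorProduct.smul_tmul', smul_assoc, ← Algebra.TensorProduct.one_def, one_smul]
  · change s' (bimoduleCat.of k E M (op e • m)) = _ • s' (bimoduleCat.of k E M m)
    rw [← map_smul, bimoduleCat.tmul_smul, one_smul]

/-- The map `(a ⊗ b) m ↦ a m ⊗ b` from the free bimodule on the set `M` to `M ⊗ₖ E`. -/
noncomputable def freeToRight : (M →₀ E ⊗[k] Eᵐᵒᵖ) →ₗ[k] M ⊗[k] E :=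
  Finsupp.lsum k fun m => TensorProduct.map ((leftAction k E M).flip m)
    (opLinearEquiv k : E ≃ₗ[k] Eᵐᵒᵖ).symm.toLinearMap

theorem freeToRight_single (m : M) (a : E) (b : Eᵐᵒᵖ) :
    freeToRight (Finsupp.single m (a ⊗ₜ[k] b)) = (a • m) ⊗ₜ b.unop := by
  rw [freeToRight, Finsupp.lsum_single]
  rfl

/-- The map `(a ⊗ b) m ↦ m b ⊗ a` from the free bimodule on the set `M` to `M ⊗ₖ Eᵐᵒᵖ`. -/
noncomputable def freeToLeft : (M →₀ E ⊗[k] Eᵐᵒᵖ) →ₗ[k] M ⊗[k] Eᵐᵒᵖ :=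
  Finsupp.lsum k fun m => TensorProduct.map ((leftAction k Eᵐᵒᵖ M).flip m)
    (opLinearEquiv k : E ≃ₗ[k] Eᵐᵒᵖ).toLinearMap ∘ₗ (TensorProduct.comm k E Eᵐᵒᵖ).toLinearMap

theorem freeToLeft_single (m : M) (a : E) (b : Eᵐᵒᵖ) :
    freeToLeft (Finsupp.single m (a ⊗ₜ[k] b)) = (b • m) ⊗ₜ op a := by
  rw [freeToLeft, Finsupp.lsum_single]
  rfl

theorem free_induction {motive : (M →₀ E ⊗[k] Eᵐᵒᵖ) → Prop} (x : M →₀ E ⊗[k] Eᵐᵒᵖ)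
    (zero : motive 0) (single : ∀ m a b, motive (Finsupp.single m (a ⊗ₜ b)))
    (add : ∀ x y, motive x → motive y → motive (x + y)) : motive x := by
  induction x using Finsupp.induction_linear with
  | zero => exact zero
  | add x y hx hy => exact add x y hx hy
  | single m z =>
    induction z with
    | zero => rw [Finsupp.single_zero]; exact zero
    | tmul a b => exact single m a b
    | add x y hx hy => rw [Finsupp.single_add]; exact add _ _ hx hy

/-- A projective bimodule `M` is a direct summand of `M ⊗ₖ E`. -/
theorem IsProjectiveBimodule.exists_right_section (h : IsProjectiveBimodule k E E M) :
    ∃ s : M →ₗ[k] M ⊗[k] E,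
      (∀ e m, s (leftAction k E M e m) = (leftAction k E M e).rTensor E (s m)) ∧
      (∀ e m, s (rightAction k E M e m) = (LinearMap.mulRight k e).lTensor M (s m)) ∧
      ∀ m, TensorProduct.lift (rightAction k E M).flip (s m) = m := by
  obtain ⟨σ, h1, h2, h3⟩ := h.exists_section
  refine ⟨freeToRight ∘ₗ σ, fun e m => ?_, fun e m => ?_, fun m => ?_⟩
  · rw [LinearMap.comp_apply, LinearMap.comp_apply, leftAction_apply, h1]
    induction σ m using free_induction with
    | zero => simp
    | single m a b =>
      rw [Finsupp.smul_single, smul_eq_mul, Algebra.TensorProduct.tmul_mul_tmul, one_mul,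
        freeToRight_single, freeToRight_single, LinearMap.rTensor_tmul, leftAction_apply, mul_smul]
    | add x y hx hy => rw [smul_add, map_add, map_add, map_add, hx, hy]
  · rw [LinearMap.comp_apply, LinearMap.comp_apply, rightAction_apply, h2]
    induction σ m using free_induction with
    | zero => simp
    | single m a b =>
      rw [Finsupp.smul_single, smul_eq_mul, Algebra.TensorProduct.tmul_mul_tmul, one_mul,
        freeToRight_single, freeToRight_single, LinearMap.lTensor_tmul, unop_mul, unop_op,
        LinearMap.mulRight_apply]
    | add x y hx hy => rw [smul_add, map_add, map_add, map_add, hx, hy]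
  · rw [LinearMap.comp_apply]
    refine (bimoduleCat.of k E M).injective (Eq.trans ?_ (h3 m))
    induction σ m using free_induction with
    | zero => simp
    | single m a b =>
      rw [freeToRight_single, Finsupp.linearCombination_single, bimoduleCat.tmul_smul,
        TensorProduct.lift.tmul, LinearMap.flip_apply, rightAction_apply, op_unop, ← smul_comm]
    | add x y hx hy =>
      rw [map_add, map_add, map_add, map_add, hx, hy]

/-- A projective bimodule `M` is a direct summand of `E ⊗ₖ M`, with `E ⊗ₖ M` written as
`M ⊗ₖ Eᵐᵒᵖ`. -/
theorem IsProjectiveBimodule.exists_left_section (h : IsProjectiveBimodule k E E M) :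
    ∃ s : M →ₗ[k] M ⊗[k] Eᵐᵒᵖ,
      (∀ e m, s (rightAction k E M e m) = (rightAction k E M e).rTensor Eᵐᵒᵖ (s m)) ∧
      (∀ e m, s (leftAction k E M e m) = (LinearMap.mulRight k (op e)).lTensor M (s m)) ∧
      ∀ m, TensorProduct.lift ((leftAction k E M) ∘ₗ
        (opLinearEquiv k : E ≃ₗ[k] Eᵐᵒᵖ).symm.toLinearMap).flip (s m) = m := by
  obtain ⟨σ, h1, h2, h3⟩ := h.exists_section
  refine ⟨freeToLeft ∘ₗ σ, fun e m => ?_, fun e m => ?_, fun m => ?_⟩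
  · rw [LinearMap.comp_apply, LinearMap.comp_apply, rightAction_apply, h2]
    induction σ m using free_induction with
    | zero => simp
    | single m a b =>
      rw [Finsupp.smul_single, smul_eq_mul, Algebra.TensorProduct.tmul_mul_tmul, one_mul,
        freeToLeft_single, freeToLeft_single, LinearMap.rTensor_tmul, rightAction_apply, mul_smul]
    | add x y hx hy => rw [smul_add, map_add, map_add, map_add, hx, hy]
  · rw [LinearMap.comp_apply, LinearMap.comp_apply, leftAction_apply, h1]
    induction σ m using free_induction with
    | zero => simp
    | single m a b =>
      rw [Finsupp.smul_single, smul_eq_mul, Algebra.TensorProduct.tmul_mul_tmul, one_mul,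
        freeToLeft_single, freeToLeft_single, LinearMap.lTensor_tmul, op_mul,
        LinearMap.mulRight_apply]
    | add x y hx hy => rw [smul_add, map_add, map_add, map_add, hx, hy]
  · rw [LinearMap.comp_apply]
    refine (bimoduleCat.of k E M).injective (Eq.trans ?_ (h3 m))
    induction σ m using free_induction with
    | zero => simp
    | single m a b =>
      rw [freeToLeft_single, Finsupp.linearCombination_single, bimoduleCat.tmul_smul]
      rfl
    | add x y hx hy =>
      rw [map_add, map_add, map_add, map_add, hx, hy]

theorem tensorProduct_mul_bijective (k A B : Type u) [Field k] [Ring A] [Algebra k A] [Ring B]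
    [Algebra k B] : Function.Bijective (TensorProduct.lift ((LinearMap.mul k (A ⊗[k] B)).compl₁₂
      (Algebra.TensorProduct.includeLeft : A →ₐ[k] A ⊗[k] B).toLinearMap
      (Algebra.TensorProduct.includeRight : B →ₐ[k] A ⊗[k] B).toLinearMap)) := by
  convert Function.bijective_id using 1
  funext x
  induction x with
  | zero => simp
  | tmul a b => simp
  | add x y hx hy => rw [map_add, hx, hy]; rfl

theorem tensorProduct_mul_bijective' (k A B : Type u) [Field k] [Ring A] [Algebra k A] [Ring B]
    [Algebra k B] : Function.Bijective (TensorProduct.lift ((LinearMap.mul k (A ⊗[k] B)).compl₁₂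
      (Algebra.TensorProduct.includeRight : B →ₐ[k] A ⊗[k] B).toLinearMap
      (Algebra.TensorProduct.includeLeft : A →ₐ[k] A ⊗[k] B).toLinearMap)) := by
  convert (TensorProduct.comm k B A).bijective using 1
  funext x
  induction x with
  | zero => simp
  | tmul a b => simp
  | add x y hx hy => rw [map_add, hx, hy, map_add]

theorem projective_restrictScalars_includeLeft (k A B : Type u) [Field k] [Ring A] [Algebra k A]
    [Ring B] [Algebra k B] (P : ModuleCat.{u} (A ⊗[k] B)) (hP : Projective P) :
    Projective ((ModuleCat.restrictScalars
      (Algebra.TensorProduct.includeLeft : A →ₐ[k] A ⊗[k] B).toRingHom).obj P) :=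
  have := projective_of_tensor_bijective
    (Algebra.TensorProduct.includeRight : B →ₐ[k] A ⊗[k] B) Algebra.TensorProduct.includeLeft
    (fun b a => by simp) (tensorProduct_mul_bijective' k A B)
  projective_restrictScalars _ P hP

theorem projective_restrictScalars_includeRight (k A B : Type u) [Field k] [Ring A] [Algebra k A]
    [Ring B] [Algebra k B] (P : ModuleCat.{u} (A ⊗[k] B)) (hP : Projective P) :
    Projective ((ModuleCat.restrictScalars
      (Algebra.TensorProduct.includeRight : B →ₐ[k] A ⊗[k] B).toRingHom).obj P) :=
  have := projective_of_tensor_bijective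
    (Algebra.TensorProduct.includeLeft : A →ₐ[k] A ⊗[k] B) Algebra.TensorProduct.includeRight
    (fun b a => by simp) (tensorProduct_mul_bijective k A B)
  projective_restrictScalars _ P hP

theorem IsProjectiveBimodule.projective (h : IsProjectiveBimodule k E E M) :
    Projective (bimoduleCat k E M) :=
  have : Module.Projective (E ⊗[k] Eᵐᵒᵖ) (bimoduleCat k E M) := h
  ModuleCat.projective_of_categoryTheory_projective (bimoduleCat k E M)

theorem IsProjectiveBimodule.projective_left (h : IsProjectiveBimodule k E E M) :
    Module.Projective E M := by
  let P := (ModuleCat.restrictScalars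
    (Algebra.TensorProduct.includeLeft : E →ₐ[k] E ⊗[k] Eᵐᵒᵖ).toRingHom).obj (bimoduleCat k E M)
  have : Projective P := projective_restrictScalars_includeLeft k E Eᵐᵒᵖ _ h.projective
  have h1 : Module.Projective E P := ModuleCat.projective_of_module_projective P
  let e : P ≃ₗ[E] M :=
    { toFun := (bimoduleCat.of k E M).symm
      invFun := bimoduleCat.of k E M
      left_inv := fun _ => rfl
      right_inv := fun _ => rfl
      map_add' := fun _ _ => rfl
      map_smul' := fun (e : E) m =>
        (bimoduleCat.tmul_smul e 1 ((bimoduleCat.of k E M).symm m)).trans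
        (congrArg (fun x : M => e • x) (one_smul Eᵐᵒᵖ ((bimoduleCat.of k E M).symm m))) }
  exact Module.Projective.of_equiv e

theorem IsProjectiveBimodule.projective_right (h : IsProjectiveBimodule k E E M) :
    Module.Projective Eᵐᵒᵖ M := by
  let P := (ModuleCat.restrictScalars
    (Algebra.TensorProduct.includeRight : Eᵐᵒᵖ →ₐ[k] E ⊗[k] Eᵐᵒᵖ).toRingHom).obj (bimoduleCat k E M)
  have : Projective P := projective_restrictScalars_includeRight k E Eᵐᵒᵖ _ h.projective
  have h1 : Module.Projective Eᵐᵒᵖ P := ModuleCat.projective_of_module_projective P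
  let e : P ≃ₗ[Eᵐᵒᵖ] M :=
    { toFun := (bimoduleCat.of k E M).symm
      invFun := bimoduleCat.of k E M
      left_inv := fun _ => rfl
      right_inv := fun _ => rfl
      map_add' := fun _ _ => rfl
      map_smul' := fun (e : Eᵐᵒᵖ) m =>
        (bimoduleCat.tmul_smul 1 e ((bimoduleCat.of k E M).symm m)).trans
        (one_smul E (e • (bimoduleCat.of k E M).symm m)) }
  exact Module.Projective.of_equiv e

end BimoduleSections

/-! ### Restricting the cohomology of a square-zero extension -/

/-- An algebra `Λ = E ⊕ M` which is the trivial square-zero extension of `E` by the bimodule `M`. That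
the products of elements of `M` vanish is part of `ρ_mul` and of the multiplicativity of `π`. -/
structure TrivialExtension (k E M L : Type u) [Field k] [Ring E] [Algebra k E] [AddCommGroup M]
    [Module k M] [Module E M] [Module Eᵐᵒᵖ M] [Ring L] [Algebra k L] where
  /-- The inclusion of the subalgebra. -/
  ι : E →ₐ[k] L
  /-- The projection onto the subalgebra. -/
  π : L →ₐ[k] E
  /-- The inclusion of the ideal. -/
  j : M →ₗ[k] L
  /-- The projection onto the ideal. -/
  ρ : L →ₗ[k] M
  decomp : ∀ x, ι (π x) + j (ρ x) = x
  π_ι : ∀ e, π (ι e) = e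
  ρ_ι : ∀ e, ρ (ι e) = 0
  π_j : ∀ m, π (j m) = 0
  ρ_j : ∀ m, ρ (j m) = m
  ρ_mul : ∀ x y, ρ (x * y) = π x • ρ y + op (π y) • ρ x

namespace TrivialExtension

open Abelian

variable {k E M L : Type u} [Field k] [Ring E] [Algebra k E] [AddCommGroup M]
  [Module k M] [Module E M] [Module Eᵐᵒᵖ M] [SMulCommClass E Eᵐᵒᵖ M] [IsScalarTower k E M]
  [IsScalarTower k Eᵐᵒᵖ M] [Ring L] [Algebra k L] (D : TrivialExtension k E M L)

theorem ext_iff {x y : L} (h1 : D.π x = D.π y) (h2 : D.ρ x = D.ρ y) : x = y := by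
  rw [← D.decomp x, ← D.decomp y, h1, h2]

theorem ρ_one : D.ρ 1 = 0 := by rw [← map_one D.ι, D.ρ_ι]

theorem j_smul (e : E) (m : M) : D.j (e • m) = D.ι e * D.j m :=
  D.ext_iff (by simp [D.π_j]) (by simp [D.ρ_j, D.ρ_mul, D.ρ_ι, D.π_ι])

theorem j_op_smul (e : E) (m : M) : D.j (op e • m) = D.j m * D.ι e :=
  D.ext_iff (by simp [D.π_j]) (by simp [D.ρ_j, D.ρ_mul, D.ρ_ι, D.π_ι])

theorem projective_left (h : IsProjectiveBimodule k E E M) :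
    Module.Projective E ((ModuleCat.restrictScalars D.ι.toRingHom).obj (ModuleCat.of L L)) := by
  have := h.projective_left
  let e : (E × M) ≃ₗ[E] (ModuleCat.restrictScalars D.ι.toRingHom).obj (ModuleCat.of L L) :=
    { toFun := fun x => D.ι x.1 + D.j x.2
      invFun := fun (x : L) => (D.π x, D.ρ x)
      left_inv := fun x => by ext <;> simp [D.π_ι, D.π_j, D.ρ_ι, D.ρ_j]
      right_inv := D.decomp
      map_add' := fun x y => by
        rw [Prod.fst_add, Prod.snd_add, map_add, map_add]
        exact add_add_add_comm _ _ _ _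
      map_smul' := fun e x => by
        rw [Prod.smul_fst, Prod.smul_snd, smul_eq_mul, map_mul, D.j_smul]
        exact (mul_add (D.ι e) (D.ι x.1) (D.j x.2)).symm }
  exact Module.Projective.of_equiv e

theorem projective_right (h : IsProjectiveBimodule k E E M) :
    Module.Projective Eᵐᵒᵖ ((ModuleCat.restrictScalars D.ι.op.toRingHom).obj
      (ModuleCat.of Lᵐᵒᵖ Lᵐᵒᵖ)) := by
  have := h.projective_right
  let e : (Eᵐᵒᵖ × M) ≃ₗ[Eᵐᵒᵖ] (ModuleCat.restrictScalars D.ι.op.toRingHom).obj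
      (ModuleCat.of Lᵐᵒᵖ Lᵐᵒᵖ) :=
    { toFun := fun x => op (D.ι x.1.unop + D.j x.2)
      invFun := fun (x : Lᵐᵒᵖ) => (op (D.π x.unop), D.ρ x.unop)
      left_inv := fun x => by ext <;> simp [D.π_ι, D.π_j, D.ρ_ι, D.ρ_j]
      right_inv := fun (x : Lᵐᵒᵖ) => congrArg op (D.decomp x.unop)
      map_add' := fun x y => by
        have h : D.ι (x.1 + y.1).unop + D.j (x.2 + y.2) =
            (D.ι x.1.unop + D.j x.2) + (D.ι y.1.unop + D.j y.2) := by
          rw [MulOpposite.unop_add, map_add, map_add]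
          exact add_add_add_comm _ _ _ _
        exact congrArg op h
      map_smul' := fun e x => by
        have h : D.ι (e * x.1).unop + D.j (e • x.2) = (D.ι x.1.unop + D.j x.2) * D.ι e.unop := by
          rw [unop_mul, map_mul, add_mul, ← D.j_op_smul, op_unop]
        exact congrArg op h }
  exact Module.Projective.of_equiv e

/-- The extension `E → Λ` acting from the left. -/
noncomputable def left (h : IsProjectiveBimodule k E E M) : OneSidedExtension k E L M where
  ι := D.ι
  π := D.π.toLinearMap
  j := D.j
  ρ := D.ρ
  lact e := leftAction k E M e
  ract := rightAction k E M
  s := h.exists_right_section.choose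
  decomp := D.decomp
  ρ_one := D.ρ_one
  ρ_j := D.ρ_j
  ρ_mul e x := by rw [D.ρ_mul, D.π_ι, D.ρ_ι, smul_zero, add_zero]; rfl
  j_lact := D.j_smul
  j_ract := D.j_op_smul
  s_lact := h.exists_right_section.choose_spec.1
  s_ract := h.exists_right_section.choose_spec.2.1
  ract_s := h.exists_right_section.choose_spec.2.2
  projective := D.projective_left h

/-- The extension `Eᵐᵒᵖ → Λᵐᵒᵖ`, that is, the extension `E → Λ` acting from the right. -/
noncomputable def right (h : IsProjectiveBimodule k E E M) :
    OneSidedExtension k Eᵐᵒᵖ Lᵐᵒᵖ M where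
  ι := D.ι.op
  π := D.π.op.toLinearMap
  j := (opLinearEquiv k : L ≃ₗ[k] Lᵐᵒᵖ).toLinearMap ∘ₗ D.j
  ρ := D.ρ ∘ₗ (opLinearEquiv k : L ≃ₗ[k] Lᵐᵒᵖ).symm.toLinearMap
  lact e := rightAction k E M e.unop
  ract := leftAction k E M ∘ₗ (opLinearEquiv k : E ≃ₗ[k] Eᵐᵒᵖ).symm.toLinearMap
  s := h.exists_left_section.choose
  decomp x := congrArg op (D.decomp x.unop)
  ρ_one := D.ρ_one
  ρ_j := D.ρ_j
  ρ_mul e x := by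
    change D.ρ (x.unop * D.ι e.unop) = _
    rw [D.ρ_mul, D.π_ι, D.ρ_ι, smul_zero, zero_add]
    rfl
  j_lact e m := congrArg op (D.j_op_smul e.unop m)
  j_ract e m := congrArg op (D.j_smul e.unop m)
  s_lact e m := h.exists_left_section.choose_spec.1 e.unop m
  s_ract e m := h.exists_left_section.choose_spec.2.1 e.unop m
  ract_s := h.exists_left_section.choose_spec.2.2
  projective := D.projective_right h

theorem _root_.mem_closure_includeLeft_mul_includeRight {A B : Type u} [Ring A] [Algebra k A]
    [Ring B] [Algebra k B] (x : A ⊗[k] B) :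
    x ∈ AddSubmonoid.closure {x | ∃ (a : A) (b : B), x = a ⊗ₜ[k] (1 : B) * (1 : A) ⊗ₜ[k] b} := by
  induction x with
  | zero => exact zero_mem _
  | tmul a b => exact AddSubmonoid.subset_closure ⟨a, b, by simp⟩
  | add x y hx hy => exact add_mem hx hy

/-- The extension of algebras `E ⊗ Λᵐᵒᵖ → Λ ⊗ Λᵐᵒᵖ`. -/
noncomputable def leftTensor :
    TensorExtension k E L Lᵐᵒᵖ (E ⊗[k] Lᵐᵒᵖ) (L ⊗[k] Lᵐᵒᵖ) D.ι where
  φ := Algebra.TensorProduct.map D.ι (AlgHom.id k _)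
  ε := Algebra.TensorProduct.includeLeft
  υ := Algebra.TensorProduct.includeRight
  a := Algebra.TensorProduct.includeLeft
  φ_ε e := by simp
  comm e u := by simp
  comm' e u := by simp
  generate := mem_closure_includeLeft_mul_includeRight
  bijective := by
    have h : (Algebra.TensorProduct.map D.ι (AlgHom.id k Lᵐᵒᵖ)).comp
        Algebra.TensorProduct.includeRight = Algebra.TensorProduct.includeRight := by
      ext; simp
    rw [h]
    exact tensorProduct_mul_bijective k L Lᵐᵒᵖ

/-- The extension of algebras `E ⊗ Eᵐᵒᵖ → E ⊗ Λᵐᵒᵖ`. -/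
noncomputable def rightTensor :
    TensorExtension k Eᵐᵒᵖ Lᵐᵒᵖ E (E ⊗[k] Eᵐᵒᵖ) (E ⊗[k] Lᵐᵒᵖ) D.ι.op where
  φ := Algebra.TensorProduct.map (AlgHom.id k _) D.ι.op
  ε := Algebra.TensorProduct.includeRight
  υ := Algebra.TensorProduct.includeLeft
  a := Algebra.TensorProduct.includeRight
  φ_ε e := by simp
  comm e u := by simp
  comm' e u := by simp
  generate x := by
    induction x with
    | zero => exact zero_mem _
    | tmul a b => exact AddSubmonoid.subset_closure ⟨b, a, by simp⟩
    | add x y hx hy => exact add_mem hx hy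
  bijective := by
    have h : (Algebra.TensorProduct.map (AlgHom.id k E) D.ι.op).comp
        Algebra.TensorProduct.includeLeft = Algebra.TensorProduct.includeLeft := by
      ext; simp
    rw [h]
    exact tensorProduct_mul_bijective' k E Lᵐᵒᵖ

/-- The split extension `E ⊗ Λᵐᵒᵖ → Λ ⊗ Λᵐᵒᵖ`. -/
noncomputable def splitLeft (h : IsProjectiveBimodule k E E M) :
    SplitExtension k E (E ⊗[k] Lᵐᵒᵖ) (L ⊗[k] Lᵐᵒᵖ) Lᵐᵒᵖ M :=
  (D.left h).splitExtension D.leftTensor (tensorProduct_mul_bijective k E Lᵐᵒᵖ)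

/-- The split extension `E ⊗ Eᵐᵒᵖ → E ⊗ Λᵐᵒᵖ`. -/
noncomputable def splitRight (h : IsProjectiveBimodule k E E M) :
    SplitExtension k Eᵐᵒᵖ (E ⊗[k] Eᵐᵒᵖ) (E ⊗[k] Lᵐᵒᵖ) E M :=
  (D.right h).splitExtension D.rightTensor (tensorProduct_mul_bijective' k E Eᵐᵒᵖ)

/-- Restriction of scalars from `Λ ⊗ Λᵐᵒᵖ` to `E ⊗ Λᵐᵒᵖ`. -/
noncomputable abbrev resLeft : ModuleCat.{u} (L ⊗[k] Lᵐᵒᵖ) ⥤ ModuleCat.{u} (E ⊗[k] Lᵐᵒᵖ) :=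
  ModuleCat.restrictScalars
    (Algebra.TensorProduct.map D.ι (AlgHom.id k _) : E ⊗[k] Lᵐᵒᵖ →ₐ[k] L ⊗[k] Lᵐᵒᵖ).toRingHom

/-- Restriction of scalars from `E ⊗ Λᵐᵒᵖ` to `E ⊗ Eᵐᵒᵖ`. -/
noncomputable abbrev resRight : ModuleCat.{u} (E ⊗[k] Lᵐᵒᵖ) ⥤ ModuleCat.{u} (E ⊗[k] Eᵐᵒᵖ) :=
  ModuleCat.restrictScalars
    (Algebra.TensorProduct.map (AlgHom.id k _) D.ι.op : E ⊗[k] Eᵐᵒᵖ →ₐ[k] E ⊗[k] Lᵐᵒᵖ).toRingHom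

/-- An additive map between modules over a tensor product `A ⊗ B` is linear if it is
compatible with pure tensors. -/
noncomputable def _root_.tensorHom {A B : Type u} [Ring A] [Algebra k A] [Ring B] [Algebra k B]
    {X Y : ModuleCat.{u} (A ⊗[k] B)} (f : X →+ Y)
    (hf : ∀ (a : A) (b : B) (x : X), f ((a ⊗ₜ[k] b) • x) = (a ⊗ₜ[k] b) • f x) : X ⟶ Y :=
  ModuleCat.ofHom
    { toFun := f
      map_add' := map_add f
      map_smul' := fun t x => by
        rw [RingHom.id_apply]
        induction t with
        | zero => rw [zero_smul, zero_smul, map_zero]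
        | tmul a b => exact hf a b x
        | add t t' ht ht' => rw [add_smul, add_smul, map_add, ht, ht'] }

/-- The regular bimodule of `Λ`, restricted to an `E`-bimodule. -/
noncomputable abbrev resRegular : ModuleCat.{u} (E ⊗[k] Eᵐᵒᵖ) :=
  D.resRight.obj (D.resLeft.obj (regularBimodule k L))

/-- The underlying additive group of `resRegular` is `Λ`. -/
def resOf : L ≃+ D.resRegular := AddEquiv.refl L

theorem tmul_smul_resOf (a : E) (b : Eᵐᵒᵖ) (x : L) :
    (a ⊗ₜ[k] b) • D.resOf x = D.resOf (D.ι a * x * D.ι b.unop) := by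
  refine (bimoduleCat.tmul_smul (k := k) (M := L) (D.ι a) (op (D.ι b.unop)) x).trans ?_
  rw [op_smul_eq_mul, smul_eq_mul, ← mul_assoc]
  rfl

theorem _root_.tmul_smul_bimodule (a : E) (b : Eᵐᵒᵖ) (x : E) :
    (a ⊗ₜ[k] b) • bimoduleCat.of k E E x = bimoduleCat.of k E E (a * x * b.unop) := by
  rw [bimoduleCat.tmul_smul, ← op_unop b, op_smul_eq_mul, smul_eq_mul, ← mul_assoc]
  rfl

/-- The inclusion `E → Λ` as a morphism of `E`-bimodules. -/
noncomputable def inl : regularBimodule k E ⟶ D.resRegular :=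
  tensorHom (X := bimoduleCat k E E)
    ((D.resOf.toAddMonoidHom.comp D.ι.toRingHom.toAddMonoidHom).comp
      (bimoduleCat.of k E E).symm.toAddMonoidHom) fun a b x => by
    obtain ⟨x, rfl⟩ := (bimoduleCat.of k E E).surjective x
    rw [tmul_smul_bimodule]
    change D.resOf (D.ι (a * x * b.unop)) = _ • D.resOf (D.ι x)
    rw [tmul_smul_resOf, map_mul D.ι, map_mul D.ι]

/-- The projection `Λ → E` as a morphism of `E`-bimodules. -/
noncomputable def fst : D.resRegular ⟶ regularBimodule k E :=
  tensorHom (Y := bimoduleCat k E E)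
    ((bimoduleCat.of k E E).toAddMonoidHom.comp (D.π.toRingHom.toAddMonoidHom.comp
      D.resOf.symm.toAddMonoidHom)) fun a b x => by
    obtain ⟨x, rfl⟩ := D.resOf.surjective x
    rw [tmul_smul_resOf]
    change bimoduleCat.of k E E (D.π (D.ι a * x * D.ι b.unop)) =
      _ • bimoduleCat.of k E E (D.π x)
    rw [tmul_smul_bimodule, map_mul D.π, map_mul D.π, D.π_ι, D.π_ι]

/-- The inclusion `M → Λ` as a morphism of `E`-bimodules. -/
noncomputable def inr : bimoduleCat k E M ⟶ D.resRegular :=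
  tensorHom ((D.resOf.toAddMonoidHom.comp D.j.toAddMonoidHom).comp
      (bimoduleCat.of k E M).symm.toAddMonoidHom) fun a b x => by
    obtain ⟨x, rfl⟩ := (bimoduleCat.of k E M).surjective x
    rw [bimoduleCat.tmul_smul]
    change D.resOf (D.j (a • b • x)) = _ • D.resOf (D.j x)
    rw [tmul_smul_resOf, D.j_smul, ← op_unop b, D.j_op_smul, mul_assoc]
    rfl

/-- The projection `Λ → M` as a morphism of `E`-bimodules. -/
noncomputable def snd : D.resRegular ⟶ bimoduleCat k E M :=
  tensorHom ((bimoduleCat.of k E M).toAddMonoidHom.comp (D.ρ.toAddMonoidHom.comp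
      D.resOf.symm.toAddMonoidHom)) fun a b x => by
    obtain ⟨x, rfl⟩ := D.resOf.surjective x
    rw [tmul_smul_resOf]
    change bimoduleCat.of k E M (D.ρ (D.ι a * x * D.ι b.unop)) =
      _ • bimoduleCat.of k E M (D.ρ x)
    rw [bimoduleCat.tmul_smul, D.ρ_mul, D.ρ_mul, D.ρ_ι, D.ρ_ι, D.π_ι, D.π_ι, smul_zero, smul_zero,
      zero_add, add_zero, ← smul_comm, op_unop]

theorem fst_inl_add_snd_inr : D.fst ≫ D.inl + D.snd ≫ D.inr = 𝟙 _ := by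
  ext x
  exact congrArg D.resOf (D.decomp x)

/-- The `k`-linear map from the Hochschild cohomology of `Λ` to that of `E` given by restriction
along `E → Λ` and projection of the coefficients. -/
noncomputable def restriction (n : ℕ) :
    HochschildCohomology k L n →ₗ[k] HochschildCohomology k E n :=
  Ext.precompOfLinear (Ext.mk₀ D.inl) k _ (zero_add n) ∘ₗ
    Ext.postcompOfLinear (Ext.mk₀ D.fst) k _ (add_zero n) ∘ₗ
      D.resRight.mapExtLinearMap k _ _ n ∘ₗ D.resLeft.mapExtLinearMap k _ _ n

theorem restriction_apply {n : ℕ} (x : HochschildCohomology k L n) :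
    D.restriction n x = (Ext.mk₀ D.inl).comp
      (((x.mapExactFunctor D.resLeft).mapExactFunctor D.resRight).comp (Ext.mk₀ D.fst)
        (add_zero n)) (zero_add n) := rfl

end TrivialExtension

/-! ### Injectivity of the restriction -/

namespace TrivialExtension

open Abelian ModuleCat

variable {k E M L : Type u} [Field k] [Ring E] [Algebra k E] [AddCommGroup M]
  [Module k M] [Module E M] [Module Eᵐᵒᵖ M] [SMulCommClass E Eᵐᵒᵖ M] [IsScalarTower k E M]
  [IsScalarTower k Eᵐᵒᵖ M] [Ring L] [Algebra k L] (D : TrivialExtension k E M L)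

/-- The underlying additive group of `Λ`, restricted to an `E`-`Λ`-bimodule, is `Λ`. -/
def resLeftOf : L ≃+ D.resLeft.obj (regularBimodule k L) := AddEquiv.refl L

theorem tmul_smul_resLeftOf (a : E) (b : Lᵐᵒᵖ) (x : L) :
    (a ⊗ₜ[k] b) • D.resLeftOf x = D.resLeftOf (D.ι a * x * b.unop) := by
  refine (bimoduleCat.tmul_smul (k := k) (M := L) (D.ι a) b x).trans ?_
  rw [← op_unop b, op_smul_eq_mul, smul_eq_mul, ← mul_assoc]
  rfl

/-- Every morphism from the `E`-`Λ`-bimodule `Λ` to a cosyzygy `Hom(Λ, Y) / Y` lifts to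
`Hom(Λ, Y)`: the image `c` of `1` is a linear map `M → Y`, and `z ↦ c (ρ z)` is the required
lift, up to coinduction. -/
theorem exists_lift_toCosyzygy (h : IsProjectiveBimodule k E E M)
    (Y : ModuleCat.{u} (E ⊗[k] Lᵐᵒᵖ))
    (g : D.resLeft.obj (regularBimodule k L) ⟶ (D.splitRight h).cosyzygy Y) :
    ∃ g', g' ≫ (D.splitRight h).toCosyzygy Y = g := by
  let c := g.hom (D.resLeftOf 1)
  let κ : M →ₗ[k] Y := (D.splitRight h).cosyzygyEval Y c
  -- The left and right actions of `E` agree on `c`, as they do on `1`; so `κ` is right linear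
  -- because it lies in the cosyzygy, and left linear because `E` acts in the same way on `c`.
  have hc (e : E) : (e ⊗ₜ[k] (1 : Lᵐᵒᵖ)) • c = ((1 : E) ⊗ₜ[k] op (D.ι e)) • c := by
    have h1 := g.hom.map_smul (e ⊗ₜ[k] (1 : Lᵐᵒᵖ)) (D.resLeftOf 1)
    have h2 := g.hom.map_smul ((1 : E) ⊗ₜ[k] op (D.ι e)) (D.resLeftOf 1)
    rw [tmul_smul_resLeftOf] at h1 h2
    rw [← h1, ← h2]
    simp
  have hφε (e : E) : (D.splitRight h).φ ((D.splitRight h).ε (op e)) =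
      (1 : E) ⊗ₜ[k] op (D.ι e) := by
    change Algebra.TensorProduct.map (AlgHom.id k E) D.ι.op (1 ⊗ₜ op e) = _
    rw [Algebra.TensorProduct.map_tmul]
    rfl
  have hφυ (e : E) : (D.splitRight h).φ ((D.splitRight h).υ e) =
      e ⊗ₜ[k] (1 : Lᵐᵒᵖ) := by
    change Algebra.TensorProduct.map (AlgHom.id k E) D.ι.op (e ⊗ₜ 1) = _
    rw [Algebra.TensorProduct.map_tmul, map_one]
    rfl
  have hκ1 (e : E) (m : M) : κ (op e • m) = ((1 : E) ⊗ₜ[k] op (D.ι e)) • κ m := by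
    rw [← hφε]
    exact SplitExtension.cosyzygyEval_lact c (op e) m
  have hκ2 (e : E) (m : M) : κ (e • m) = (e ⊗ₜ[k] (1 : Lᵐᵒᵖ)) • κ m := by
    refine (SplitExtension.cosyzygyEval_smul_E c (op e) m).symm.trans ?_
    rw [hφε, ← hc, ← hφυ]
    exact SplitExtension.cosyzygyEval_smul_U c e m
  have hκ3 (e : E) (b : Eᵐᵒᵖ) (m : M) :
      κ (e • b • m) = (e ⊗ₜ[k] op (D.ι b.unop)) • κ m := by
    rw [hκ2, ← op_unop b, hκ1, ← mul_smul, Algebra.TensorProduct.tmul_mul_tmul, mul_one, one_mul]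
    rfl
  let f : (D.splitRight h).res.obj (D.resLeft.obj (regularBimodule k L)) ⟶
      (D.splitRight h).res.obj Y :=
    tensorHom (κ.toAddMonoidHom.comp (D.ρ.toAddMonoidHom.comp D.resOf.symm.toAddMonoidHom))
      fun a b x => by
        obtain ⟨x, rfl⟩ := D.resOf.surjective x
        refine (congrArg (fun y => κ (D.ρ y)) (D.tmul_smul_resOf a b x)).trans ?_
        change κ (D.ρ (D.ι a * x * D.ι b.unop)) = _
        rw [D.ρ_mul, D.ρ_mul, D.ρ_ι, D.ρ_ι, D.π_ι, D.π_ι, smul_zero, smul_zero,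
          zero_add, add_zero, ← smul_comm, op_unop]
        exact hκ3 a b (D.ρ x)
  let g' := ModuleCat.RestrictionCoextensionAdj.HomEquiv.fromRestriction
    (D.splitRight h).φ.toRingHom f
  have hg' (x : L) (t : E ⊗[k] Lᵐᵒᵖ) : (D.splitRight h).ev (g'.hom (D.resLeftOf x)) t =
      κ (D.ρ (D.resLeftOf.symm (t • D.resLeftOf x))) := rfl
  have h1 : (D.splitRight h).toCosyzygy Y (g'.hom (D.resLeftOf 1)) = c := by
    apply SplitExtension.cosyzygyEval_injective Y
    rw [SplitExtension.cosyzygyEval_toCosyzygy]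
    ext m
    rw [SplitExtension.coindEval_apply, hg', hg', one_smul, AddEquiv.symm_apply_apply, D.ρ_one,
      map_zero, smul_zero, sub_zero]
    change κ (D.ρ (D.resLeftOf.symm (((1 : E) ⊗ₜ[k] op (D.j m)) • D.resLeftOf 1))) = κ m
    rw [tmul_smul_resLeftOf, AddEquiv.symm_apply_apply, map_one, one_mul, one_mul, unop_op, D.ρ_j]
  refine ⟨g', ?_⟩
  ext x
  obtain ⟨x, rfl⟩ := D.resLeftOf.surjective x
  have hx : D.resLeftOf x = ((1 : E) ⊗ₜ[k] op x) • D.resLeftOf 1 := by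
    rw [tmul_smul_resLeftOf, map_one, one_mul, one_mul, unop_op]
  rw [hx, map_smul, map_smul]
  exact congrArg _ h1

theorem _root_.ext_eq_zero_of_comp_mk₀_eq_zero {C : Type*} [Category C] [Abelian C] [HasExt.{u} C]
    {X Y Z A : C} {f : A ⟶ X} {g : A ⟶ Y} {f' : X ⟶ A} {g' : Y ⟶ A}
    (h : f ≫ f' + g ≫ g' = 𝟙 A) {n : ℕ} (y : Ext Z A n)
    (hf : y.comp (Ext.mk₀ f) (add_zero n) = 0) (hg : y.comp (Ext.mk₀ g) (add_zero n) = 0) :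
    y = 0 := by
  rw [← y.comp_mk₀_id, ← h, Ext.mk₀_add, Ext.comp_add, ← Ext.mk₀_comp_mk₀, ← Ext.mk₀_comp_mk₀,
    ← Ext.comp_assoc _ _ _ (add_zero n) _ (by lia), ← Ext.comp_assoc _ _ _ (add_zero n) _ (by lia),
    hf, hg, Ext.zero_comp, Ext.zero_comp, add_zero]

theorem _root_.ext_eq_zero_of_mk₀_comp_eq_zero {C : Type*} [Category C] [Abelian C] [HasExt.{u} C]
    {X Y Z A : C} {f : A ⟶ X} {g : A ⟶ Y} {f' : X ⟶ A} {g' : Y ⟶ A}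
    (h : f ≫ f' + g ≫ g' = 𝟙 A) {n : ℕ} (y : Ext A Z n)
    (hf : (Ext.mk₀ f').comp y (zero_add n) = 0) (hg : (Ext.mk₀ g').comp y (zero_add n) = 0) :
    y = 0 := by
  rw [← y.mk₀_id_comp, ← h, Ext.mk₀_add, Ext.add_comp, ← Ext.mk₀_comp_mk₀, ← Ext.mk₀_comp_mk₀,
    Ext.comp_assoc _ _ _ _ (zero_add n) (by lia), Ext.comp_assoc _ _ _ _ (zero_add n) (by lia),
    hf, hg, Ext.comp_zero, Ext.comp_zero, add_zero]

theorem _root_.projective_restrictScalars_includeLeft_regularBimodule (k E : Type u)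
    [Field k] [Ring E] [Algebra k E] :
    Projective ((ModuleCat.restrictScalars
      (Algebra.TensorProduct.includeLeft : E →ₐ[k] E ⊗[k] Eᵐᵒᵖ).toRingHom).obj
        (regularBimodule k E)) := by
  let e : E ≃ₗ[E] (ModuleCat.restrictScalars
      (Algebra.TensorProduct.includeLeft : E →ₐ[k] E ⊗[k] Eᵐᵒᵖ).toRingHom).obj
        (bimoduleCat k E E) :=
    { toFun := bimoduleCat.of k E E
      invFun := (bimoduleCat.of k E E).symm
      left_inv := fun _ => rfl
      right_inv := fun _ => rfl
      map_add' := fun _ _ => rfl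
      map_smul' := fun (a : E) (x : E) => by
        refine Eq.trans ?_ (bimoduleCat.tmul_smul a 1 x).symm
        rw [one_smul] }
  exact @ModuleCat.projective_of_categoryTheory_projective _ _ _ (Module.Projective.of_equiv e)

theorem projective_resU_resLeft_regularBimodule :
    Projective ((ModuleCat.restrictScalars
      (Algebra.TensorProduct.includeRight : Lᵐᵒᵖ →ₐ[k] E ⊗[k] Lᵐᵒᵖ).toRingHom).obj
        (D.resLeft.obj (regularBimodule k L))) := by
  let e : Lᵐᵒᵖ ≃ₗ[Lᵐᵒᵖ] (ModuleCat.restrictScalars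
      (Algebra.TensorProduct.includeRight : Lᵐᵒᵖ →ₐ[k] E ⊗[k] Lᵐᵒᵖ).toRingHom).obj
        (D.resLeft.obj (regularBimodule k L)) :=
    { toFun := fun x => D.resLeftOf x.unop
      invFun := fun x => op (D.resLeftOf.symm x)
      left_inv := fun _ => rfl
      right_inv := fun _ => rfl
      map_add' := fun _ _ => rfl
      map_smul' := fun (a : Lᵐᵒᵖ) (x : Lᵐᵒᵖ) => by
        refine Eq.trans ?_ (D.tmul_smul_resLeftOf 1 a x.unop).symm
        rw [map_one, one_mul]
        rfl }
  exact @ModuleCat.projective_of_categoryTheory_projective _ _ _ (Module.Projective.of_equiv e)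

theorem subsingleton_iterate_cosyzygy (h : IsProjectiveBimodule k E E M) {d : ℕ}
    (hd : Subsingleton (BimoduleTensorPower k E M d)) (Y : ModuleCat.{u} (L ⊗[k] Lᵐᵒᵖ)) :
    Subsingleton ((D.splitLeft h).cosyzygy^[d] Y : ModuleCat.{u} (L ⊗[k] Lᵐᵒᵖ)) := by
  refine SplitExtension.subsingleton_iterate_cosyzygy Y fun f hf => ?_
  have htop : balancedRelations k E M d = ⊤ := 
    Submodule.unique_quotient_iff_eq_top.1 ⟨Unique.mk' _⟩
  have hle : balancedRelations k E M d ≤ LinearMap.ker (PiTensorProduct.lift f) := by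
    refine Submodule.span_le.2 ?_
    rintro _ ⟨x, r, i, j, hij, rfl⟩
    refine LinearMap.mem_ker.2 ?_
    rw [map_sub, PiTensorProduct.lift.tprod, PiTensorProduct.lift.tprod, sub_eq_zero]
    exact hf x r i j hij
  ext x
  rw [← PiTensorProduct.lift.tprod]
  have : PiTensorProduct.tprod k x ∈ balancedRelations k E M d := htop ▸ Submodule.mem_top
  exact hle this

/-- If `M` is a projective bimodule with `M ^ {⊗ d} = 0` and `Ext(E, M) = 0`, then the restriction
of Hochschild cohomology is injective in degrees at least `d`. -/
theorem restriction_injective (h : IsProjectiveBimodule k E E M)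
    (hEM : ∀ n (x : Ext (regularBimodule k E) (bimoduleCat k E M) n), x = 0) {d : ℕ} (h0 : 0 < d)
    (hd : Subsingleton (BimoduleTensorPower k E M d)) {n : ℕ} (hn : d ≤ n) :
    Function.Injective (D.restriction n) := by
  have := h.projective
  rw [injective_iff_map_eq_zero]
  intro x hx
  obtain ⟨n, rfl⟩ := Nat.exists_eq_add_of_le' (Nat.one_le_of_lt (h0.trans_le hn))
  refine SplitExtension.eq_zero_of_res_eq_zero_of_subsingleton (D := D.splitLeft h)
    D.projective_resU_resLeft_regularBimodule h0
    (D.subsingleton_iterate_cosyzygy h hd _) hn x ?_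
  refine SplitExtension.eq_zero_of_comp_res_eq_zero (D := D.splitRight h) D.inl
    (projective_restrictScalars_includeLeft_regularBimodule k E) ?_ (D.exists_lift_toCosyzygy h) n _
    (x.mapExactFunctor D.resLeft) ?_
  · intro n W z hz
    exact ext_eq_zero_of_mk₀_comp_eq_zero D.fst_inl_add_snd_inr z hz (Ext.eq_zero_of_projective _)
  · refine ext_eq_zero_of_comp_mk₀_eq_zero D.fst_inl_add_snd_inr _ ?_ (hEM _ _)
    exact (Ext.comp_assoc _ _ _ _ (add_zero _) (by lia)).trans hx

end TrivialExtension

/-! ### Dimension shifting -/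

section Decomposition

open Limits Abelian

universe w v₁ v₂ v₃ u₁ u₂ u₃

theorem projective_map_X₁_of_shortExact {C : Type u₁} [Category.{v₁} C] [Abelian C]
    {D : Type u₂} [Category.{v₂} D] [Abelian D] (F : C ⥤ D) [F.Additive]
    [PreservesFiniteLimits F] [PreservesFiniteColimits F] {S : ShortComplex C}
    (hS : S.ShortExact) (h₂ : Projective (F.obj S.X₂)) (h₃ : Projective (F.obj S.X₃)) :
    Projective (F.obj S.X₁) := by
  have : Projective (S.map F).X₃ := h₃
  have s := (hS.map_of_exact F).splittingOfProjective
  exact Retract.projective (Y := F.obj S.X₂) ⟨(S.map F).f, s.r, s.f_r⟩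

/-- Dimension shifting keeps objects projective relative to exact functors which preserve
projective objects. -/
theorem exists_eq_comp_extClass_comp {C : Type u₁} [Category.{v₁} C] [Abelian C] [HasExt.{w} C]
    [EnoughProjectives C] {D₁ : Type u₂} [Category.{v₂} D₁] [Abelian D₁] {D₂ : Type u₃}
    [Category.{v₃} D₂] [Abelian D₂] (F₁ : C ⥤ D₁) (F₂ : C ⥤ D₂) [F₁.Additive] [F₂.Additive]
    [PreservesFiniteLimits F₁] [PreservesFiniteColimits F₁] [PreservesFiniteLimits F₂]
    [PreservesFiniteColimits F₂] (h₁ : ∀ P, Projective P → Projective (F₁.obj P))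
    (h₂ : ∀ P, Projective P → Projective (F₂.obj P)) {Q X : C} (hQ₁ : Projective (F₁.obj Q))
    (hQ₂ : Projective (F₂.obj Q)) {n : ℕ} (x : Ext.{w} Q X (n + 1)) :
    ∃ (S : ShortComplex C) (hS : S.ShortExact) (f : S.X₁ ⟶ X) (y : Ext Q S.X₃ n),
      Projective (F₁.obj S.X₃) ∧ Projective (F₂.obj S.X₃) ∧
        x = y.comp (hS.extClass.comp (Ext.mk₀ f) (add_zero 1)) rfl := by
  induction n generalizing Q with
  | zero =>
    let P : ProjectivePresentation Q := Classical.arbitrary _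
    let S := ShortComplex.mk _ _ (kernel.condition P.f)
    have hS : S.ShortExact := { exact := ShortComplex.exact_kernel P.f }
    have : Projective S.X₂ := P.projective
    obtain ⟨y, rfl⟩ := Ext.contravariant_sequence_exact₃ hS X x
      (Ext.eq_zero_of_projective _) (add_zero 1)
    obtain ⟨f, rfl⟩ := (Ext.mk₀_bijective _ _).2 y
    exact ⟨S, hS, f, Ext.mk₀ (𝟙 Q), hQ₁, hQ₂, (Ext.mk₀_id_comp _).symm⟩
  | succ n ih =>
    let P : ProjectivePresentation Q := Classical.arbitrary _
    let S := ShortComplex.mk _ _ (kernel.condition P.f)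
    have hS : S.ShortExact := { exact := ShortComplex.exact_kernel P.f }
    have : Projective S.X₂ := P.projective
    obtain ⟨x', rfl⟩ := Ext.contravariant_sequence_exact₃ hS X x
      (Ext.eq_zero_of_projective _) (add_comm 1 _)
    obtain ⟨S', hS', f, y, h₁', h₂', rfl⟩ := ih
      (projective_map_X₁_of_shortExact F₁ hS (h₁ _ P.projective) hQ₁)
      (projective_map_X₁_of_shortExact F₂ hS (h₂ _ P.projective) hQ₂) x'
    exact ⟨S', hS', f, hS.extClass.comp y (add_comm 1 n), h₁', h₂',
      (Ext.comp_assoc _ _ _ _ _ (by lia)).symm⟩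

end Decomposition

/-! ### Bimodules glued from a square-zero ideal and one-sided functionals -/

open ModuleCat in
/-- A right linear and a left linear functional on a bimodule. -/
structure FunctionalPair (k E : Type u) [Field k] [Ring E] [Algebra k E]
    (P : ModuleCat.{u} (E ⊗[k] Eᵐᵒᵖ)) where
  /-- The right linear functional. -/
  right : P →ₗ[k] E
  /-- The left linear functional. -/
  left : P →ₗ[k] E
  right_smul : ∀ (e : E) x, right (((1 : E) ⊗ₜ[k] op e) • x) = right x * e
  left_smul : ∀ (e : E) x, left ((e ⊗ₜ[k] (1 : Eᵐᵒᵖ)) • x) = e * left x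

namespace TrivialExtension

open Abelian ModuleCat

variable {k E M L : Type u} [Field k] [Ring E] [Algebra k E] [AddCommGroup M]
  [Module k M] [Module E M] [Module Eᵐᵒᵖ M] [SMulCommClass E Eᵐᵒᵖ M] [IsScalarTower k E M]
  [IsScalarTower k Eᵐᵒᵖ M] [Ring L] [Algebra k L] (D : TrivialExtension k E M L)
  (h : IsProjectiveBimodule k E E M) {P : ModuleCat.{u} (E ⊗[k] Eᵐᵒᵖ)}

/-- The action of the enveloping algebra on a bimodule. -/
noncomputable def _root_.envAction (k : Type u) {E : Type u} [Field k] [Ring E] [Algebra k E]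
    (P : ModuleCat.{u} (E ⊗[k] Eᵐᵒᵖ)) : E ⊗[k] Eᵐᵒᵖ →ₐ[k] Module.End k P :=
  Algebra.lsmul k k P

theorem _root_.envAction_apply (t : E ⊗[k] Eᵐᵒᵖ) (x : P) : envAction k P t x = t • x := rfl

variable (F : FunctionalPair k E P)

theorem _root_.FunctionalPair.right_smul' (a e : E) (x : P) :
    F.right ((a ⊗ₜ[k] op e) • x) = F.right ((a ⊗ₜ[k] (1 : Eᵐᵒᵖ)) • x) * e := by
  rw [← F.right_smul, ← mul_smul, Algebra.TensorProduct.tmul_mul_tmul, one_mul, mul_one]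

theorem _root_.FunctionalPair.left_smul' (a e : E) (x : P) :
    F.left ((e ⊗ₜ[k] op a) • x) = e * F.left (((1 : E) ⊗ₜ[k] op a) • x) := by
  rw [← F.left_smul, ← mul_smul, Algebra.TensorProduct.tmul_mul_tmul, one_mul, mul_one]

/-- The map `m ⊗ a ⊗ x ↦ m φ(a x)`, for a right linear functional `φ`. -/
noncomputable def rightPairing (M : Type u) [AddCommGroup M] [Module k M] [Module Eᵐᵒᵖ M]
    [IsScalarTower k Eᵐᵒᵖ M] (F : FunctionalPair k E P) : M ⊗[k] E →ₗ[k] P →ₗ[k] M :=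
  TensorProduct.lift <| LinearMap.mk₂ k
    (fun m a => (rightAction k E M).flip m ∘ₗ F.right ∘ₗ
      envAction k P (a ⊗ₜ[k] (1 : Eᵐᵒᵖ)))
    (fun m m' a => by rw [map_add, LinearMap.add_comp])
    (fun c m a => by rw [map_smul, LinearMap.smul_comp])
    (fun m a a' => by rw [TensorProduct.add_tmul, map_add, LinearMap.comp_add, LinearMap.comp_add])
    (fun c m a => by rw [← TensorProduct.smul_tmul', map_smul, LinearMap.comp_smul,
      LinearMap.comp_smul])

theorem rightPairing_tmul (m : M) (a : E) (x : P) :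
    rightPairing M F (m ⊗ₜ a) x = op (F.right ((a ⊗ₜ[k] (1 : Eᵐᵒᵖ)) • x)) • m := rfl

/-- The map `m ⊗ a ⊗ x ↦ ψ(x a) m`, for a left linear functional `ψ`. -/
noncomputable def leftPairing (M : Type u) [AddCommGroup M] [Module k M] [Module E M]
    [IsScalarTower k E M] (F : FunctionalPair k E P) : M ⊗[k] Eᵐᵒᵖ →ₗ[k] P →ₗ[k] M :=
  TensorProduct.lift <| LinearMap.mk₂ k
    (fun m a => (leftAction k E M).flip m ∘ₗ F.left ∘ₗ
      envAction k P ((1 : E) ⊗ₜ[k] a))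
    (fun m m' a => by rw [map_add, LinearMap.add_comp])
    (fun c m a => by rw [map_smul, LinearMap.smul_comp])
    (fun m a a' => by rw [TensorProduct.tmul_add, map_add, LinearMap.comp_add, LinearMap.comp_add])
    (fun c m a => by rw [TensorProduct.tmul_smul, map_smul, LinearMap.comp_smul,
      LinearMap.comp_smul])

theorem leftPairing_tmul (m : M) (a : Eᵐᵒᵖ) (x : P) :
    leftPairing M F (m ⊗ₜ a) x = F.left (((1 : E) ⊗ₜ[k] a) • x) • m := rfl

/-- The product `m * x = ∑ m' φ(a x)`, where `m ↦ ∑ m' ⊗ a` splits `M ⊗ E → M`. -/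
noncomputable def mulRight : M →ₗ[k] P →ₗ[k] M :=
  rightPairing M F ∘ₗ h.exists_right_section.choose

/-- The product `x * m = ∑ ψ(x a) m'`, where `m ↦ ∑ a ⊗ m'` splits `E ⊗ M → M`. -/
noncomputable def mulLeft : M →ₗ[k] P →ₗ[k] M :=
  leftPairing M F ∘ₗ h.exists_left_section.choose

theorem mulRight_smul (e : E) (m : M) (x : P) :
    mulRight h F (e • m) x = e • mulRight h F m x := by
  have h1 := h.exists_right_section.choose_spec.1 e m
  rw [leftAction_apply] at h1
  rw [mulRight, LinearMap.comp_apply, LinearMap.comp_apply, h1]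
  induction h.exists_right_section.choose m with
  | zero => simp
  | tmul m a =>
    rw [LinearMap.rTensor_tmul, rightPairing_tmul, rightPairing_tmul, leftAction_apply,
      ← smul_comm]
  | add y z hy hz => simp only [map_add, LinearMap.add_apply, smul_add, hy, hz]

theorem mulRight_op_smul (e : E) (m : M) (x : P) :
    mulRight h F (op e • m) x = mulRight h F m ((e ⊗ₜ[k] (1 : Eᵐᵒᵖ)) • x) := by
  have h1 := h.exists_right_section.choose_spec.2.1 e m
  rw [rightAction_apply] at h1
  rw [mulRight, LinearMap.comp_apply, LinearMap.comp_apply, h1]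
  induction h.exists_right_section.choose m with
  | zero => simp
  | tmul m a =>
    rw [LinearMap.lTensor_tmul, rightPairing_tmul, rightPairing_tmul, LinearMap.mulRight_apply,
      ← mul_smul (a ⊗ₜ[k] (1 : Eᵐᵒᵖ)), Algebra.TensorProduct.tmul_mul_tmul, one_mul]
  | add y z hy hz => simp only [map_add, LinearMap.add_apply, hy, hz]

theorem mulRight_smul_op (e : E) (m : M) (x : P) :
    mulRight h F m (((1 : E) ⊗ₜ[k] op e) • x) = op e • mulRight h F m x := by
  rw [mulRight, LinearMap.comp_apply]
  induction h.exists_right_section.choose m with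
  | zero => simp
  | tmul m a =>
    rw [rightPairing_tmul, rightPairing_tmul,
      ← mul_smul (a ⊗ₜ[k] (1 : Eᵐᵒᵖ)), Algebra.TensorProduct.tmul_mul_tmul, one_mul, mul_one,
      F.right_smul', op_mul, mul_smul]
  | add y z hy hz => simp only [map_add, LinearMap.add_apply, hy, hz, smul_add]

/-- If the functional is also left linear at `x`, the product is the expected one. -/
theorem mulRight_eq (m : M) (x : P)
    (hx : ∀ a : E, F.right ((a ⊗ₜ[k] (1 : Eᵐᵒᵖ)) • x) = a * F.right x) :
    mulRight h F m x = op (F.right x) • m := by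
  have h1 := h.exists_right_section.choose_spec.2.2 m
  rw [mulRight, LinearMap.comp_apply]
  conv_rhs => rw [← h1]
  induction h.exists_right_section.choose m with
  | zero => simp
  | tmul m a =>
    rw [rightPairing_tmul, hx, op_mul, mul_smul, TensorProduct.lift.tmul]
    rfl
  | add y z hy hz => simp only [map_add, LinearMap.add_apply, hy, hz, smul_add]

theorem mulLeft_op_smul (e : E) (m : M) (x : P) :
    mulLeft h F (op e • m) x = op e • mulLeft h F m x := by
  have h1 := h.exists_left_section.choose_spec.1 e m
  rw [rightAction_apply] at h1
  rw [mulLeft, LinearMap.comp_apply, LinearMap.comp_apply, h1]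
  induction h.exists_left_section.choose m with
  | zero => simp
  | tmul m a =>
    rw [LinearMap.rTensor_tmul, leftPairing_tmul, leftPairing_tmul, rightAction_apply,
      smul_comm]
  | add y z hy hz => simp only [map_add, LinearMap.add_apply, smul_add, hy, hz]

theorem mulLeft_smul (e : E) (m : M) (x : P) :
    mulLeft h F (e • m) x = mulLeft h F m (((1 : E) ⊗ₜ[k] op e) • x) := by
  have h1 := h.exists_left_section.choose_spec.2.1 e m
  rw [leftAction_apply] at h1
  rw [mulLeft, LinearMap.comp_apply, LinearMap.comp_apply, h1]
  induction h.exists_left_section.choose m with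
  | zero => simp
  | tmul m a =>
    rw [LinearMap.lTensor_tmul, leftPairing_tmul, leftPairing_tmul, LinearMap.mulRight_apply,
      ← mul_smul ((1 : E) ⊗ₜ[k] a), Algebra.TensorProduct.tmul_mul_tmul, one_mul]
  | add y z hy hz => simp only [map_add, LinearMap.add_apply, hy, hz]

theorem mulLeft_smul_left (e : E) (m : M) (x : P) :
    mulLeft h F m ((e ⊗ₜ[k] (1 : Eᵐᵒᵖ)) • x) = e • mulLeft h F m x := by
  rw [mulLeft, LinearMap.comp_apply]
  induction h.exists_left_section.choose m with
  | zero => simp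
  | tmul m a =>
    rw [leftPairing_tmul, leftPairing_tmul,
      ← mul_smul ((1 : E) ⊗ₜ[k] a), Algebra.TensorProduct.tmul_mul_tmul, one_mul, mul_one,
      ← op_unop a, F.left_smul', mul_smul]
  | add y z hy hz => simp only [map_add, LinearMap.add_apply, hy, hz, smul_add]

theorem mulLeft_eq (m : M) (x : P)
    (hx : ∀ a : E, F.left (((1 : E) ⊗ₜ[k] op a) • x) = F.left x * a) :
    mulLeft h F m x = F.left x • m := by
  have h1 := h.exists_left_section.choose_spec.2.2 m
  rw [mulLeft, LinearMap.comp_apply]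
  conv_rhs => rw [← h1]
  induction h.exists_left_section.choose m with
  | zero => simp
  | tmul m a =>
    rw [leftPairing_tmul, ← op_unop a, hx, mul_smul, TensorProduct.lift.tmul]
    rfl
  | add y z hy hz => simp only [map_add, LinearMap.add_apply, hy, hz, smul_add]

/-- The left action `λ (m, x) = (π(λ) m + ρ(λ) * x, π(λ) x)` of `Λ` on `M × P`. -/
noncomputable def glueLeft : L →ₐ[k] Module.End k (M × P) :=
  AlgHom.ofLinearMap
    { toFun := fun l => (leftAction k E M (D.π l) ∘ₗ LinearMap.fst k M P +
          mulRight h F (D.ρ l) ∘ₗ LinearMap.snd k M P).prod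
        (envAction k P (D.π l ⊗ₜ[k] (1 : Eᵐᵒᵖ)) ∘ₗ LinearMap.snd k M P)
      map_add' := fun l l' => by
        refine LinearMap.ext fun x => Prod.ext ?_ ?_
        · simp; abel
        · simp [TensorProduct.add_tmul]
      map_smul' := fun c l => by
        refine LinearMap.ext fun x => Prod.ext ?_ ?_
        · simp
        · simp [← TensorProduct.smul_tmul'] }
    (by
      refine LinearMap.ext fun x => Prod.ext ?_ ?_
      · simp [D.ρ_one]
      · simp [← Algebra.TensorProduct.one_def])
    (fun l l' => by
      refine LinearMap.ext fun x => Prod.ext ?_ ?_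
      · simp [D.ρ_mul, mul_smul, mulRight_smul, mulRight_op_smul, envAction_apply, add_assoc]
      · simp [envAction_apply, ← mul_smul])

/-- The right action `(m, x) λ = (m π(λ) + x * ρ(λ), x π(λ))` of `Λ` on `M × P`. -/
noncomputable def glueRight : Lᵐᵒᵖ →ₐ[k] Module.End k (M × P) :=
  AlgHom.ofLinearMap
    { toFun := fun l => (rightAction k E M (D.π l.unop) ∘ₗ LinearMap.fst k M P +
          mulLeft h F (D.ρ l.unop) ∘ₗ LinearMap.snd k M P).prod
        (envAction k P ((1 : E) ⊗ₜ[k] op (D.π l.unop)) ∘ₗ LinearMap.snd k M P)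
      map_add' := fun l l' => by
        refine LinearMap.ext fun x => Prod.ext ?_ ?_
        · simp; abel
        · simp [TensorProduct.tmul_add]
      map_smul' := fun c l => by
        refine LinearMap.ext fun x => Prod.ext ?_ ?_
        · simp
        · simp }
    (by
      refine LinearMap.ext fun x => Prod.ext ?_ ?_
      · simp [D.ρ_one]
      · simp [← Algebra.TensorProduct.one_def])
    (fun l l' => by
      refine LinearMap.ext fun x => Prod.ext ?_ ?_
      · simp [D.ρ_mul, mul_smul, mulLeft_smul, mulLeft_op_smul, envAction_apply, add_assoc]
        abel
      · simp [envAction_apply, ← mul_smul])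

theorem glueLeft_apply (l : L) (x : M × P) : D.glueLeft h F l x =
    (D.π l • x.1 + mulRight h F (D.ρ l) x.2, (D.π l ⊗ₜ[k] (1 : Eᵐᵒᵖ)) • x.2) := rfl

theorem glueRight_apply (l : Lᵐᵒᵖ) (x : M × P) : D.glueRight h F l x =
    (op (D.π l.unop) • x.1 + mulLeft h F (D.ρ l.unop) x.2,
      ((1 : E) ⊗ₜ[k] op (D.π l.unop)) • x.2) := rfl

/-- The `Λ`-bimodule `M × P` with both actions twisted by the products `mulRight` and `mulLeft`. The
two products need not be compatible with each other, since `M` acts trivially on `M`. -/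
noncomputable def glue : ModuleCat.{u} (L ⊗[k] Lᵐᵒᵖ) :=
  letI : Module (L ⊗[k] Lᵐᵒᵖ) (M × P) := Module.compHom _
    (Algebra.TensorProduct.lift (D.glueLeft h F) (D.glueRight h F) fun l l' => by
      refine LinearMap.ext fun x => ?_
      rw [Module.End.mul_apply, Module.End.mul_apply, glueLeft_apply, glueRight_apply,
        glueRight_apply, glueLeft_apply]
      refine Prod.ext ?_ ?_
      · simp only [smul_add, mulRight_smul_op, mulLeft_smul_left]
        rw [smul_comm]
        abel
      · simp only [← mul_smul, Algebra.TensorProduct.tmul_mul_tmul, one_mul, mul_one]).toRingHom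
  ModuleCat.of _ (M × P)

/-- The underlying additive group of `glue` is `M × P`. -/
def glueOf : M × P ≃+ D.glue h F := AddEquiv.refl _

theorem tmul_smul_glueOf (a : L) (b : Lᵐᵒᵖ) (x : M × P) :
    (a ⊗ₜ[k] b) • D.glueOf h F x =
      D.glueOf h F (D.glueLeft h F a (D.glueRight h F b x)) := rfl

theorem mulRight_congr {P' : ModuleCat.{u} (E ⊗[k] Eᵐᵒᵖ)} {F' : FunctionalPair k E P'}
    (g : P ⟶ P') (hr : ∀ x, F'.right (g x) = F.right x) (m : M) (x : P) :
    mulRight h F' m (g x) = mulRight h F m x := by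
  rw [mulRight, mulRight, LinearMap.comp_apply, LinearMap.comp_apply]
  induction h.exists_right_section.choose m with
  | zero => simp
  | tmul m a =>
    rw [rightPairing_tmul, rightPairing_tmul, ← hr]
    exact congrArg (fun y => op (F'.right y) • m) (map_smul g.hom _ _).symm
  | add y z hy hz => simp only [map_add, LinearMap.add_apply, hy, hz]

theorem mulLeft_congr {P' : ModuleCat.{u} (E ⊗[k] Eᵐᵒᵖ)} {F' : FunctionalPair k E P'}
    (g : P ⟶ P') (hl : ∀ x, F'.left (g x) = F.left x) (m : M) (x : P) :
    mulLeft h F' m (g x) = mulLeft h F m x := by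
  rw [mulLeft, mulLeft, LinearMap.comp_apply, LinearMap.comp_apply]
  induction h.exists_left_section.choose m with
  | zero => simp
  | tmul m a =>
    rw [leftPairing_tmul, leftPairing_tmul, ← hl]
    exact congrArg (fun y => F'.left y • m) (map_smul g.hom _ _).symm
  | add y z hy hz => simp only [map_add, LinearMap.add_apply, hy, hz]

variable {F}

theorem glueLeft_map {P' : ModuleCat.{u} (E ⊗[k] Eᵐᵒᵖ)} {F' : FunctionalPair k E P'}
    (g : P ⟶ P') (hr : ∀ x, F'.right (g x) = F.right x) (l : L) (x : M × P) :
    D.glueLeft h F' l (x.1, g x.2) = ((D.glueLeft h F l x).1, g (D.glueLeft h F l x).2) :=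
  Prod.ext (congrArg (D.π l • x.1 + ·) (mulRight_congr h F g hr _ _))
    (map_smul g.hom _ _).symm

theorem glueRight_map {P' : ModuleCat.{u} (E ⊗[k] Eᵐᵒᵖ)} {F' : FunctionalPair k E P'}
    (g : P ⟶ P') (hl : ∀ x, F'.left (g x) = F.left x) (l : Lᵐᵒᵖ) (x : M × P) :
    D.glueRight h F' l (x.1, g x.2) = ((D.glueRight h F l x).1, g (D.glueRight h F l x).2) :=
  Prod.ext (congrArg (op (D.π l.unop) • x.1 + ·) (mulLeft_congr h F g hl _ _))
    (map_smul g.hom _ _).symm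

/-- The glued bimodules are functorial in the bimodule with its pair of functionals. -/
noncomputable def glueMap {P' : ModuleCat.{u} (E ⊗[k] Eᵐᵒᵖ)} {F' : FunctionalPair k E P'}
    (g : P ⟶ P') (hr : ∀ x, F'.right (g x) = F.right x) (hl : ∀ x, F'.left (g x) = F.left x) :
    D.glue h F ⟶ D.glue h F' :=
  tensorHom ((D.glueOf h F').toAddMonoidHom.comp
    (((AddMonoidHom.id M).prodMap g.hom.toAddMonoidHom).comp
      (D.glueOf h F).symm.toAddMonoidHom)) fun a b x => by
    obtain ⟨x, rfl⟩ := (D.glueOf h F).surjective x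
    rw [tmul_smul_glueOf]
    refine Eq.trans ?_ (D.tmul_smul_glueOf h F' a b (x.1, g x.2)).symm
    rw [D.glueRight_map h g hl, D.glueLeft_map h g hr]
    rfl

/-- Inflation along the projection `Λ → E`. -/
noncomputable abbrev infl : ModuleCat.{u} (E ⊗[k] Eᵐᵒᵖ) ⥤ ModuleCat.{u} (L ⊗[k] Lᵐᵒᵖ) :=
  ModuleCat.restrictScalars
    (Algebra.TensorProduct.map D.π D.π.op : L ⊗[k] Lᵐᵒᵖ →ₐ[k] E ⊗[k] Eᵐᵒᵖ).toRingHom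

theorem tmul_smul_infl (a : L) (b : Lᵐᵒᵖ) (x : P) :
    (a ⊗ₜ[k] b) • (show D.infl.obj P from x) = (D.π a ⊗ₜ[k] op (D.π b.unop)) • x := rfl

variable (F)

/-- The projection from the glued bimodule to `P`. -/
noncomputable def glueSnd : D.glue h F ⟶ D.infl.obj P :=
  tensorHom ((AddMonoidHom.snd M P).comp (D.glueOf h F).symm.toAddMonoidHom) fun a b x => by
    obtain ⟨x, rfl⟩ := (D.glueOf h F).surjective x
    rw [tmul_smul_glueOf]
    refine Eq.trans ?_ (D.tmul_smul_infl a b x.2).symm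
    change (D.π a ⊗ₜ[k] (1 : Eᵐᵒᵖ)) • ((1 : E) ⊗ₜ[k] op (D.π b.unop)) • x.2 = _
    rw [← mul_smul, Algebra.TensorProduct.tmul_mul_tmul, one_mul, mul_one]

theorem _root_.includeLeft_algebraMap_smul (c : k) (x : P) :
    ((algebraMap k E c) ⊗ₜ[k] (1 : Eᵐᵒᵖ)) • x = c • x := by
  rw [← algebraMap_smul (E ⊗[k] Eᵐᵒᵖ) c x, Algebra.TensorProduct.algebraMap_apply]

theorem _root_.includeRight_algebraMap_smul (c : k) (x : P) :
    ((1 : E) ⊗ₜ[k] op (algebraMap k E c)) • x = c • x := by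
  rw [← includeLeft_algebraMap_smul, Algebra.algebraMap_eq_smul_one, op_smul, op_one,
    TensorProduct.tmul_smul, TensorProduct.smul_tmul']

/-- Scalars act through the algebra, so one-sided linear functionals are linear over the field. -/
noncomputable def _root_.FunctionalPair.ofAddMonoidHom (r l : P →+ E)
    (hr : ∀ (e : E) x, r (((1 : E) ⊗ₜ[k] op e) • x) = r x * e)
    (hl : ∀ (e : E) x, l ((e ⊗ₜ[k] (1 : Eᵐᵒᵖ)) • x) = e * l x) : FunctionalPair k E P where
  right := { r with
            map_smul' := fun c x => by
              change r _ = c • r x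
              rw [← includeRight_algebraMap_smul, hr, Algebra.smul_def, Algebra.commutes] }
  left := { l with
            map_smul' := fun c x => by
              change l _ = c • l x
              rw [← includeLeft_algebraMap_smul, hl, Algebra.smul_def] }
  right_smul := hr
  left_smul := hl

/-- A morphism of bimodules, regarded as an additive map to `E`. -/
noncomputable def _root_.homToAlgebra (f : P ⟶ bimoduleCat k E E) : P →+ E :=
  (bimoduleCat.of k E E).symm.toAddMonoidHom.comp f.hom.toAddMonoidHom

theorem _root_.homToAlgebra_smul (f : P ⟶ bimoduleCat k E E) (a : E) (b : Eᵐᵒᵖ) (x : P) :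
    homToAlgebra f ((a ⊗ₜ[k] b) • x) = a * homToAlgebra f x * b.unop :=
  (congrArg (bimoduleCat.of k E E).symm (map_smul f.hom _ _)).trans
    (congrArg (bimoduleCat.of k E E).symm (tmul_smul_bimodule a b (homToAlgebra f x)))

/-- A morphism of bimodules is linear on both sides. -/
noncomputable def _root_.FunctionalPair.ofHom (f : P ⟶ bimoduleCat k E E) :
    FunctionalPair k E P :=
  FunctionalPair.ofAddMonoidHom (homToAlgebra f) (homToAlgebra f)
    (fun e x => by rw [homToAlgebra_smul, one_mul, unop_op])
    (fun e x => by rw [homToAlgebra_smul, unop_one, mul_one])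

/-- A morphism of bimodules defined on `X` extends to any bimodule containing `X` which admits
one-sided retractions onto `X`, as a pair of one-sided functionals. -/
noncomputable def _root_.FunctionalPair.ofRetractions {X : ModuleCat.{u} (E ⊗[k] Eᵐᵒᵖ)}
    (f : X ⟶ bimoduleCat k E E)
    (l : (ModuleCat.restrictScalars (Algebra.TensorProduct.includeLeft :
      E →ₐ[k] E ⊗[k] Eᵐᵒᵖ).toRingHom).obj P ⟶ (ModuleCat.restrictScalars
        (Algebra.TensorProduct.includeLeft : E →ₐ[k] E ⊗[k] Eᵐᵒᵖ).toRingHom).obj X)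
    (r : (ModuleCat.restrictScalars (Algebra.TensorProduct.includeRight :
      Eᵐᵒᵖ →ₐ[k] E ⊗[k] Eᵐᵒᵖ).toRingHom).obj P ⟶ (ModuleCat.restrictScalars
        (Algebra.TensorProduct.includeRight : Eᵐᵒᵖ →ₐ[k] E ⊗[k] Eᵐᵒᵖ).toRingHom).obj X) :
    FunctionalPair k E P :=
  FunctionalPair.ofAddMonoidHom ((homToAlgebra f).comp r.hom.toAddMonoidHom)
    ((homToAlgebra f).comp l.hom.toAddMonoidHom)
    (fun e x => (congrArg (homToAlgebra f) (r.hom.map_smul (op e) x)).trans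
      ((homToAlgebra_smul f 1 (op e) (r.hom x)).trans (by rw [one_mul]; rfl)))
    (fun e x => (congrArg (homToAlgebra f) (l.hom.map_smul e x)).trans
      ((homToAlgebra_smul f e 1 (l.hom x)).trans (by rw [unop_one, mul_one]; rfl)))

/-- The morphism `(m, x) ↦ f x + m` from the bimodule glued along a morphism `f : P ⟶ E` to `Λ`. -/
noncomputable def glueToRegular (f : P ⟶ bimoduleCat k E E) :
    D.glue h (FunctionalPair.ofHom f) ⟶ bimoduleCat k L L :=
  tensorHom ((bimoduleCat.of k L L).toAddMonoidHom.comp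
    ((AddMonoidHom.coprod D.j.toAddMonoidHom
      (D.ι.toRingHom.toAddMonoidHom.comp (homToAlgebra f))).comp
        (D.glueOf h (FunctionalPair.ofHom f)).symm.toAddMonoidHom)) fun a b x => by
    obtain ⟨x, rfl⟩ := (D.glueOf h (FunctionalPair.ofHom f)).surjective x
    rw [tmul_smul_glueOf]
    refine Eq.trans ?_ (tmul_smul_bimodule a b (D.j x.1 + D.ι (homToAlgebra f x.2))).symm
    refine congrArg (bimoduleCat.of k L L) ?_
    let F := FunctionalPair.ofHom f
    change D.j (D.glueLeft h F a (D.glueRight h F b x)).1 +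
      D.ι (homToAlgebra f (D.glueLeft h F a (D.glueRight h F b x)).2) = _
    have hl (y : M × P) : D.j (D.glueLeft h (FunctionalPair.ofHom f) a y).1 +
        D.ι (homToAlgebra f (D.glueLeft h (FunctionalPair.ofHom f) a y).2) =
        a * (D.j y.1 + D.ι (homToAlgebra f y.2)) := by
      rw [glueLeft_apply]
      dsimp only
      rw [mulRight_eq, homToAlgebra_smul]
      · refine D.ext_iff ?_ ?_
        · simp [D.π_j, D.π_ι]
        · simp [D.ρ_j, D.ρ_ι, D.ρ_mul, D.π_j, D.π_ι]
          rfl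
      · intro a
        refine (homToAlgebra_smul f a 1 y.2).trans (mul_one _)
    have hr (y : M × P) : D.j (D.glueRight h (FunctionalPair.ofHom f) b y).1 +
        D.ι (homToAlgebra f (D.glueRight h (FunctionalPair.ofHom f) b y).2) =
        (D.j y.1 + D.ι (homToAlgebra f y.2)) * b.unop := by
      rw [glueRight_apply]
      dsimp only
      rw [mulLeft_eq, homToAlgebra_smul]
      · refine D.ext_iff ?_ ?_
        · simp [D.π_j, D.π_ι]
        · simp [D.ρ_j, D.ρ_ι, D.ρ_mul, D.π_j, D.π_ι]
          rw [add_comm]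
          rfl
      · intro a
        refine (homToAlgebra_smul f 1 (op a) y.2).trans ?_
        rw [one_mul]
        rfl
    rw [hl, hr, mul_assoc]

end TrivialExtension

/-! ### Surjectivity of the restriction -/

namespace TrivialExtension

open Abelian ModuleCat

variable {k E M L : Type u} [Field k] [Ring E] [Algebra k E] [AddCommGroup M]
  [Module k M] [Module E M] [Module Eᵐᵒᵖ M] [SMulCommClass E Eᵐᵒᵖ M] [IsScalarTower k E M]
  [IsScalarTower k Eᵐᵒᵖ M] [Ring L] [Algebra k L] (D : TrivialExtension k E M L)
  (h : IsProjectiveBimodule k E E M)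

/-- Inflation followed by restriction is the identity. -/
noncomputable def inflRes : (D.infl ⋙ D.resLeft) ⋙ D.resRight ⟶ 𝟭 (ModuleCat (E ⊗[k] Eᵐᵒᵖ)) where
  app P := tensorHom (AddMonoidHom.id P) fun a b x => by
    change (Algebra.TensorProduct.map D.π D.π.op (Algebra.TensorProduct.map D.ι (AlgHom.id k _)
      (Algebra.TensorProduct.map (AlgHom.id k _) D.ι.op (a ⊗ₜ b)))) • (show P from x) = _
    simp only [Algebra.TensorProduct.map_tmul, AlgHom.id_apply, D.π_ι, AlgHom.op_apply_apply,
      unop_op, op_unop]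
    rfl
  naturality _ _ _ := rfl

theorem map_inflRes {X Y : ModuleCat.{u} (E ⊗[k] Eᵐᵒᵖ)} {n : ℕ} (x : Ext X Y n) :
    (((x.mapExactFunctor D.infl).mapExactFunctor D.resLeft).mapExactFunctor D.resRight).comp
      (Ext.mk₀ (D.inflRes.app Y)) (add_zero n) =
    (Ext.mk₀ (D.inflRes.app X)).comp x (zero_add n) := by
  have := mapExactFunctor_comp_natTrans_app D.inflRes x
  rwa [mapExactFunctor_id, mapExactFunctor_comp_functor, mapExactFunctor_comp_functor] at this

/-- The projection `Λ → E` as a morphism of `Λ`-bimodules. -/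
noncomputable def proj : regularBimodule k L ⟶ D.infl.obj (regularBimodule k E) :=
  tensorHom (X := bimoduleCat k L L) ((bimoduleCat.of k E E).toAddMonoidHom.comp
    (D.π.toRingHom.toAddMonoidHom.comp (bimoduleCat.of k L L).symm.toAddMonoidHom)) fun a b x => by
    obtain ⟨x, rfl⟩ := (bimoduleCat.of k L L).surjective x
    rw [tmul_smul_bimodule]
    change bimoduleCat.of k E E (D.π (a * x * b.unop)) =
      (D.π a ⊗ₜ[k] op (D.π b.unop)) • bimoduleCat.of k E E (D.π x)
    rw [tmul_smul_bimodule, map_mul D.π, map_mul D.π, unop_op]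

theorem inl_proj : D.inl ≫ D.resRight.map (D.resLeft.map D.proj) ≫
    D.inflRes.app (regularBimodule k E) = 𝟙 _ := by
  ext x
  exact congrArg (bimoduleCat.of k E E) (D.π_ι _)

variable {S : ShortComplex (ModuleCat.{u} (E ⊗[k] Eᵐᵒᵖ))} (hS : S.ShortExact)
  (F₁ : FunctionalPair k E S.X₁) (F₂ : FunctionalPair k E S.X₂)
  (hr : ∀ x, F₂.right (S.f x) = F₁.right x) (hl : ∀ x, F₂.left (S.f x) = F₁.left x)

/-- The extension of `S.X₃` by the bimodule glued from `S.X₁`. -/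
noncomputable abbrev glueSeq : ShortComplex (ModuleCat.{u} (L ⊗[k] Lᵐᵒᵖ)) :=
  ShortComplex.mk (D.glueMap h S.f hr hl) (D.glueSnd h F₂ ≫ D.infl.map S.g) (by
    ext x
    exact congrArg (fun f => f.hom ((D.glueOf h F₁).symm x).2) S.zero)

include hS in
theorem glueSeq_shortExact : (D.glueSeq h F₁ F₂ hr hl).ShortExact where
  exact := by
    have hex := (ShortComplex.ShortExact.moduleCat_exact_iff_function_exact S).1 hS.exact
    rw [ShortComplex.ShortExact.moduleCat_exact_iff_function_exact]
    intro x
    obtain ⟨x, rfl⟩ := (D.glueOf h F₂).surjective x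
    refine (hex x.2).trans ⟨fun ⟨y, hy⟩ => ⟨D.glueOf h F₁ (x.1, y), ?_⟩, fun ⟨y, hy⟩ =>
      ⟨((D.glueOf h F₁).symm y).2, ?_⟩⟩
    · exact congrArg (D.glueOf h F₂) (Prod.ext rfl hy)
    · exact congrArg (fun z => ((D.glueOf h F₂).symm z).2) hy
  mono_f := (ModuleCat.mono_iff_injective _).2 fun x y hxy => by
    obtain ⟨x, rfl⟩ := (D.glueOf h F₁).surjective x
    obtain ⟨y, rfl⟩ := (D.glueOf h F₁).surjective y
    have hxy' : (x.1, S.f x.2) = (y.1, S.f y.2) := (D.glueOf h F₂).injective hxy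
    have hinj := (ModuleCat.mono_iff_injective S.f).1 hS.mono_f
    exact congrArg (D.glueOf h F₁)
      (Prod.ext (Prod.ext_iff.1 hxy').1 (hinj (Prod.ext_iff.1 hxy').2))
  epi_g := (ModuleCat.epi_iff_surjective _).2 fun z => by
    obtain ⟨y, hy⟩ := (ModuleCat.epi_iff_surjective S.g).1 hS.epi_g z
    exact ⟨D.glueOf h F₂ (0, y), hy⟩

/-- The projection onto the second factor, from the glued sequence to the inflated one. -/
noncomputable def glueSeqHom : D.glueSeq h F₁ F₂ hr hl ⟶ S.map D.infl where
  τ₁ := D.glueSnd h F₁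
  τ₂ := D.glueSnd h F₂
  τ₃ := 𝟙 _

/-- The morphism from the glued bimodule to `Λ` lifts the morphism `f`. -/
theorem glueToRegular_fst {P : ModuleCat.{u} (E ⊗[k] Eᵐᵒᵖ)} (f : P ⟶ regularBimodule k E) :
    D.resRight.map (D.resLeft.map (D.glueToRegular h f)) ≫ D.fst =
      D.resRight.map (D.resLeft.map (D.glueSnd h (FunctionalPair.ofHom f))) ≫
        D.inflRes.app P ≫ f := by
  ext x
  obtain ⟨x, rfl⟩ := (D.glueOf h (FunctionalPair.ofHom f)).surjective x
  refine congrArg (bimoduleCat.of k E E) ?_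
  change D.π (D.j x.1 + D.ι (homToAlgebra f x.2)) = homToAlgebra f x.2
  rw [map_add, D.π_j, D.π_ι, zero_add]

theorem _root_.projective_restrictScalars_includeRight_regularBimodule (k E : Type u)
    [Field k] [Ring E] [Algebra k E] : Projective ((ModuleCat.restrictScalars
      (Algebra.TensorProduct.includeRight : Eᵐᵒᵖ →ₐ[k] E ⊗[k] Eᵐᵒᵖ).toRingHom).obj
        (regularBimodule k E)) := by
  let e : Eᵐᵒᵖ ≃ₗ[Eᵐᵒᵖ] (ModuleCat.restrictScalars
      (Algebra.TensorProduct.includeRight : Eᵐᵒᵖ →ₐ[k] E ⊗[k] Eᵐᵒᵖ).toRingHom).obj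
        (bimoduleCat k E E) :=
    { toFun := fun x => bimoduleCat.of k E E x.unop
      invFun := fun x => op ((bimoduleCat.of k E E).symm x)
      left_inv := fun _ => rfl
      right_inv := fun _ => rfl
      map_add' := fun _ _ => rfl
      map_smul' := fun (a : Eᵐᵒᵖ) (x : Eᵐᵒᵖ) => by
        refine Eq.trans ?_ (bimoduleCat.tmul_smul 1 a x.unop).symm
        rw [one_smul]
        rfl }
  exact @ModuleCat.projective_of_categoryTheory_projective _ _ _ (Module.Projective.of_equiv e)

/-- A short exact sequence whose last term becomes projective under restriction of scalars splits
after this restriction. -/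
theorem _root_.exists_retraction_of_projective {R R' : Type u} [Ring R] [Ring R'] (φ : R →+* R')
    {S : ShortComplex (ModuleCat.{u} R')} (hS : S.ShortExact)
    (h : Projective ((ModuleCat.restrictScalars.{u} φ).obj S.X₃)) :
    ∃ r : (ModuleCat.restrictScalars φ).obj S.X₂ ⟶ (ModuleCat.restrictScalars φ).obj S.X₁,
      ∀ x : S.X₁, r (S.f x) = x := by
  have : Projective (S.map (ModuleCat.restrictScalars φ)).X₃ := h
  have s := (hS.map_of_exact (ModuleCat.restrictScalars φ)).splittingOfProjective
  exact ⟨s.r, fun x => congrArg (fun g => g.hom x) s.f_r⟩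

/-- A composite of classes `y · z · f` is the restriction of a class of `Λ` as soon as the middle
factor, once inflated, lifts to a bimodule `V` to which the morphism `f` extends. -/
theorem restriction_comp_infl {X Y : ModuleCat.{u} (E ⊗[k] Eᵐᵒᵖ)} {n : ℕ}
    (y : Ext (regularBimodule k E) Y n) (z : Ext Y X 1) (f : X ⟶ regularBimodule k E)
    {V : ModuleCat.{u} (L ⊗[k] Lᵐᵒᵖ)} (w : Ext (D.infl.obj Y) V 1) (v : V ⟶ D.infl.obj X)
    (g : V ⟶ regularBimodule k L)
    (hw : w.comp (Ext.mk₀ v) (add_zero 1) = z.mapExactFunctor D.infl)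
    (hg : D.resRight.map (D.resLeft.map g) ≫ D.fst =
      D.resRight.map (D.resLeft.map v) ≫ D.inflRes.app X ≫ f) :
    D.restriction (n + 1) ((Ext.mk₀ D.proj).comp ((y.mapExactFunctor D.infl).comp
      (w.comp (Ext.mk₀ g) (add_zero 1)) rfl) (zero_add _)) =
      y.comp (z.comp (Ext.mk₀ f) (add_zero 1)) rfl := by
  have hz : (((w.mapExactFunctor D.resLeft).mapExactFunctor D.resRight).comp
      (Ext.mk₀ (D.resRight.map (D.resLeft.map g))) (add_zero 1)).comp
        (Ext.mk₀ D.fst) (add_zero 1) =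
      (Ext.mk₀ (D.inflRes.app Y)).comp (z.comp (Ext.mk₀ f) (add_zero 1)) (zero_add 1) := by
    have := congrArg (fun z => (z.mapExactFunctor D.resLeft).mapExactFunctor D.resRight) hw
    rw [Ext.mapExactFunctor_comp, Ext.mapExactFunctor_comp, Ext.mapExactFunctor_mk₀,
      Ext.mapExactFunctor_mk₀] at this
    rw [Ext.comp_assoc_of_third_deg_zero, Ext.mk₀_comp_mk₀, hg,
      ← Ext.mk₀_comp_mk₀, ← Ext.mk₀_comp_mk₀, ← Ext.comp_assoc_of_third_deg_zero,
      ← Ext.comp_assoc_of_third_deg_zero]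
    refine (congrArg (fun z => (z.comp (Ext.mk₀ (D.inflRes.app X)) (add_zero 1)).comp
      (Ext.mk₀ f) (add_zero 1)) this).trans ?_
    rw [map_inflRes, Ext.comp_assoc _ _ _ (zero_add 1) (add_zero 1) (by lia)]
  rw [restriction_apply]
  simp only [Ext.mapExactFunctor_comp, Ext.mapExactFunctor_mk₀]
  rw [Ext.comp_assoc_of_third_deg_zero, Ext.comp_assoc_of_third_deg_zero, hz,
    ← Ext.comp_assoc _ _ _ (add_zero n) (zero_add 1) (by lia), map_inflRes,
    Ext.comp_assoc _ _ _ (zero_add n) rfl (by lia),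
    ← Ext.comp_assoc _ _ _ (zero_add 0) (zero_add _) (by lia), Ext.mk₀_comp_mk₀,
    ← Ext.comp_assoc _ _ _ (zero_add 0) (zero_add _) (by lia), Ext.mk₀_comp_mk₀, Category.assoc,
    inl_proj, Ext.mk₀_id_comp]

include h in
/-- If `M` is a projective bimodule, then the restriction of Hochschild cohomology is surjective in
positive degrees. -/
theorem restriction_surjective (n : ℕ) : Function.Surjective (D.restriction (n + 1)) := by
  intro x
  obtain ⟨S, hS, f, y, h₁, h₂, rfl⟩ := exists_eq_comp_extClass_comp
    (ModuleCat.restrictScalars.{u} (Algebra.TensorProduct.includeLeft :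
      E →ₐ[k] E ⊗[k] Eᵐᵒᵖ).toRingHom)
    (ModuleCat.restrictScalars.{u} (Algebra.TensorProduct.includeRight :
      Eᵐᵒᵖ →ₐ[k] E ⊗[k] Eᵐᵒᵖ).toRingHom)
    (projective_restrictScalars_includeLeft k E Eᵐᵒᵖ)
    (projective_restrictScalars_includeRight k E Eᵐᵒᵖ)
    (projective_restrictScalars_includeLeft_regularBimodule k E)
    (projective_restrictScalars_includeRight_regularBimodule k E) x
  obtain ⟨l, hl⟩ := exists_retraction_of_projective _ hS h₁
  obtain ⟨r, hr⟩ := exists_retraction_of_projective _ hS h₂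
  have hW := D.glueSeq_shortExact h hS (FunctionalPair.ofHom f) (FunctionalPair.ofRetractions f l r)
    (fun x => congrArg (homToAlgebra f) (hr x)) (fun x => congrArg (homToAlgebra f) (hl x))
  -- The glued extension maps to the inflation of the given one.
  have hnat : hW.extClass.comp (Ext.mk₀ (D.glueSnd h (FunctionalPair.ofHom f))) (add_zero 1) =
      hS.extClass.mapExactFunctor D.infl := by
    rw [Ext.mapExactFunctor_extClass]
    refine (hW.extClass_naturality (hS.map_of_exact D.infl) (D.glueSeqHom h _ _ _ _)).trans ?_
    exact Ext.mk₀_id_comp _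
  refine ⟨(Ext.mk₀ D.proj).comp ((y.mapExactFunctor D.infl).comp
    (hW.extClass.comp (Ext.mk₀ (D.glueToRegular h f)) (add_zero 1)) rfl) (zero_add _), ?_⟩
  exact D.restriction_comp_infl y hS.extClass f hW.extClass _ (D.glueToRegular h f) hnat
    (D.glueToRegular_fst h f)

end TrivialExtension

/-! ### Hochschild cohomology of a product of algebras -/

open Abelian in
/-- A central element which acts by one on `X` and by zero on `Y` acts on `Ext(X, Y)` in both ways,
so that this group vanishes. -/
theorem ext_eq_zero_of_central {R : Type u} [Ring R] {X Y : ModuleCat.{u} R} (z : R)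
    (hz : ∀ r, z * r = r * z) (hX : ∀ x : X, z • x = x) (hY : ∀ y : Y, z • y = 0) {n : ℕ}
    (x : Ext X Y n) : x = 0 := by
  let η : 𝟭 (ModuleCat.{u} R) ⟶ 𝟭 (ModuleCat.{u} R) :=
    { app := fun W => ModuleCat.ofHom
        { toFun := fun w : W => z • w
          map_add' := smul_add z
          map_smul' := fun r w => by
            rw [RingHom.id_apply, ← mul_smul, hz, mul_smul] }
      naturality := fun W W' f => by
        ext w
        exact (map_smul f.hom z w).symm }
  have h := mapExactFunctor_comp_natTrans_app η x
  have h1 : η.app X = 𝟙 X := by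
    ext w
    exact hX w
  have h2 : η.app Y = 0 := by
    ext w
    exact hY w
  rw [mapExactFunctor_id, h1, h2, Ext.mk₀_zero, Ext.comp_zero] at h
  exact ((Ext.mk₀_id_comp x).symm.trans h.symm)

/-- If there are no extensions between `X` and `Y` in degree `n`, then the self-extensions of
`Z = X ⊕ Y` in this degree are the pairs of self-extensions of `X` and of `Y`. -/
theorem nonempty_ext_linearEquiv_prod {k : Type u} [Field k] {C : Type*} [Category C] [Abelian C]
    [HasExt.{u} C] [Linear k C] {X Y Z : C} {iX : X ⟶ Z} {pX : Z ⟶ X} {iY : Y ⟶ Z}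
    {pY : Z ⟶ Y} (hX : iX ≫ pX = 𝟙 X) (hY : iY ≫ pY = 𝟙 Y) (hXY : iX ≫ pY = 0)
    (hYX : iY ≫ pX = 0) (hZ : pX ≫ iX + pY ≫ iY = 𝟙 Z) {n : ℕ}
    (h₁ : ∀ x : Abelian.Ext X Y n, x = 0) (h₂ : ∀ x : Abelian.Ext Y X n, x = 0) :
    Nonempty (Abelian.Ext Z Z n ≃ₗ[k] Abelian.Ext X X n × Abelian.Ext Y Y n) := by
  open Abelian in
  -- The pull-back along `f` of the push-forward along `g`.
  let c {X Y Z W : C} (f : X ⟶ Y) (g : Z ⟶ W) : Ext Y Z n →ₗ[k] Ext X W n :=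
    Ext.precompOfLinear (Ext.mk₀ f) k _ (zero_add n) ∘ₗ
      Ext.postcompOfLinear (Ext.mk₀ g) k _ (add_zero n)
  have hc {X Y Z W : C} (f : X ⟶ Y) (g : Z ⟶ W) (x) :
    c f g x = (Ext.mk₀ f).comp (x.comp (Ext.mk₀ g) (add_zero n)) (zero_add n) := rfl
  have hcc {X Y Z W X' W' : C} (f : X ⟶ Y) (g : Z ⟶ W) (f' : X' ⟶ X) (g' : W ⟶ W') (x) :
      c f' g' (c f g x) = c (f' ≫ f) (g ≫ g') x := by
    rw [hc, hc, hc, ← Ext.mk₀_comp_mk₀, ← Ext.mk₀_comp_mk₀,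
      Ext.comp_assoc _ _ _ (zero_add n) (add_zero n) (by lia),
      ← Ext.comp_assoc _ _ _ (zero_add 0) (zero_add n) (by lia),
      Ext.comp_assoc _ _ _ (add_zero n) (add_zero 0) (by lia)]
  have hid {X Y : C} (x : Ext X Y n) : c (𝟙 X) (𝟙 Y) x = x := by
    rw [hc, Ext.comp_mk₀_id, Ext.mk₀_id_comp]
  have hz2 {X Y Z W : C} (f : X ⟶ Y) (x) : c f (0 : Z ⟶ W) x = 0 := by
    rw [hc, Ext.mk₀_zero, Ext.comp_zero, Ext.comp_zero]
  have ha1 {X Y Z W : C} (f f' : X ⟶ Y) (g : Z ⟶ W) (x) : c (f + f') g x = c f g x + c f' g x := by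
    rw [hc, hc, hc, Ext.mk₀_add, Ext.add_comp]
  have ha2 {X Y Z W : C} (f : X ⟶ Y) (g g' : Z ⟶ W) (x) : c f (g + g') x = c f g x + c f g' x := by
    rw [hc, hc, hc, Ext.mk₀_add, Ext.comp_add, Ext.comp_add]
  refine ⟨LinearEquiv.ofLinearMap ((c iX pX).prod (c iY pY)) ((c pX iX).coprod (c pY iY)) ?_ ?_⟩
  · refine LinearMap.ext fun x => Prod.ext ?_ ?_
    · simp [hcc, hX, hXY, hYX, hid, hz2]
    · simp [hcc, hY, hXY, hYX, hid, hz2]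
  · refine LinearMap.ext fun x => ?_
    simp only [LinearMap.comp_apply, LinearMap.prod_apply, Function.prod,
      LinearMap.coprod_apply, hcc, LinearMap.id_apply]
    have hXY' : c (pX ≫ iX) (pY ≫ iY) x = 0 := by
      rw [← hcc iX pY, h₁ (c iX pY x), map_zero]
    have hYX' : c (pY ≫ iY) (pX ≫ iX) x = 0 := by
      rw [← hcc iY pX, h₂ (c iY pX x), map_zero]
    conv_rhs => rw [← hid x, ← hZ, ha1, ha2, ha2, hXY', hYX', add_zero, zero_add]

/-- A direct factor `A` of an algebra `E`: the projection onto `A` and the (non-unital) inclusion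
of `A`. -/
structure DirectFactor (k E A : Type u) [Field k] [Ring E] [Algebra k E] [Ring A]
    [Algebra k A] where
  /-- The projection. -/
  p : E →ₐ[k] A
  /-- The inclusion. -/
  q : A →ₗ[k] E
  p_q : ∀ a, p (q a) = a
  q_mul : ∀ e a, q (p e * a) = e * q a
  mul_q : ∀ e a, q (a * p e) = q a * e

namespace DirectFactor

open Abelian

variable {k E A B : Type u} [Field k] [Ring E] [Algebra k E] [Ring A] [Algebra k A]
  [Ring B] [Algebra k B] (D : DirectFactor k E A)

/-- The projection between the enveloping algebras. -/
noncomputable abbrev env : E ⊗[k] Eᵐᵒᵖ →ₐ[k] A ⊗[k] Aᵐᵒᵖ := Algebra.TensorProduct.map D.p D.p.op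

/-- Inflation of bimodules along the projection. -/
noncomputable abbrev infl : ModuleCat.{u} (A ⊗[k] Aᵐᵒᵖ) ⥤ ModuleCat.{u} (E ⊗[k] Eᵐᵒᵖ) :=
  ModuleCat.restrictScalars D.env.toRingHom

theorem env_surjective : Function.Surjective D.env :=
  TensorProduct.map_surjective (fun a => ⟨D.q a, D.p_q a⟩)
    fun a => ⟨op (D.q a.unop), congrArg op (D.p_q a.unop)⟩

instance : D.infl.Full where
  map_surjective {X Y} f :=
    ⟨ModuleCat.ofHom
      { toFun := f
        map_add' := map_add f.hom
        map_smul' := fun r x => by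
          obtain ⟨r, rfl⟩ := D.env_surjective r
          exact f.hom.map_smul r x }, rfl⟩

theorem projective_env : Module.Projective (E ⊗[k] Eᵐᵒᵖ)
    ((ModuleCat.restrictScalars D.env.toRingHom).obj
      (ModuleCat.of (A ⊗[k] Aᵐᵒᵖ) (A ⊗[k] Aᵐᵒᵖ))) := by
  let q' : A ⊗[k] Aᵐᵒᵖ →ₗ[k] E ⊗[k] Eᵐᵒᵖ := TensorProduct.map D.q
    ((opLinearEquiv k).toLinearMap ∘ₗ D.q ∘ₗ (opLinearEquiv k).symm.toLinearMap)
  have hq' (a : A) (b : Aᵐᵒᵖ) : q' (a ⊗ₜ b) = D.q a ⊗ₜ op (D.q b.unop) := rfl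
  have hmul (r : E ⊗[k] Eᵐᵒᵖ) (x : A ⊗[k] Aᵐᵒᵖ) : q' (D.env r * x) = r * q' x := by
    induction r with
    | zero => rw [map_zero, zero_mul, zero_mul, map_zero]
    | add r r' h h' => rw [map_add, add_mul, add_mul, map_add, h, h']
    | tmul a b =>
      induction x with
      | zero => rw [mul_zero, map_zero, mul_zero]
      | add x x' h h' => rw [mul_add, map_add, map_add, mul_add, h, h']
      | tmul a' b' =>
        rw [Algebra.TensorProduct.map_tmul, Algebra.TensorProduct.tmul_mul_tmul, hq', hq', D.q_mul,
          Algebra.TensorProduct.tmul_mul_tmul]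
        exact congrArg (fun y => (a * D.q a') ⊗ₜ[k] op y) (D.mul_q b.unop b'.unop)
  let i : (ModuleCat.restrictScalars D.env.toRingHom).obj
      (ModuleCat.of (A ⊗[k] Aᵐᵒᵖ) (A ⊗[k] Aᵐᵒᵖ)) →ₗ[E ⊗[k] Eᵐᵒᵖ] E ⊗[k] Eᵐᵒᵖ :=
    { toFun := q'
      map_add' := map_add q'
      map_smul' := hmul }
  let s : E ⊗[k] Eᵐᵒᵖ →ₗ[E ⊗[k] Eᵐᵒᵖ] (ModuleCat.restrictScalars D.env.toRingHom).obj
      (ModuleCat.of (A ⊗[k] Aᵐᵒᵖ) (A ⊗[k] Aᵐᵒᵖ)) :=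
    { toFun := D.env
      map_add' := map_add D.env
      map_smul' := fun r x => map_mul D.env r x }
  refine Module.Projective.of_split i s (LinearMap.ext fun (x : A ⊗[k] Aᵐᵒᵖ) => ?_)
  change D.env (q' x) = x
  induction x with
  | zero => rw [map_zero, map_zero]
  | add x x' h h' => rw [map_add, map_add, h, h']
  | tmul a b =>
    rw [hq', Algebra.TensorProduct.map_tmul, D.p_q]
    exact congrArg (fun y => a ⊗ₜ[k] op y) (D.p_q b.unop)

instance : D.infl.PreservesProjectiveObjects where
  projective_obj {P} hP :=
    have := D.projective_env
    projective_restrictScalars D.env.toRingHom P hP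

/-- Inflation is an isomorphism on `Ext`. -/
noncomputable def extEquiv (X Y : ModuleCat.{u} (A ⊗[k] Aᵐᵒᵖ)) (n : ℕ) :
    Ext X Y n ≃ₗ[k] Ext (D.infl.obj X) (D.infl.obj Y) n :=
  LinearEquiv.ofBijective (D.infl.mapExtLinearMap k X Y n)
    (D.infl.mapExt_bijective_of_preservesProjectiveObjects X Y n)

/-- The algebra `A` as an `E`-bimodule. -/
noncomputable abbrev bimodule : ModuleCat.{u} (E ⊗[k] Eᵐᵒᵖ) := D.infl.obj (regularBimodule k A)

/-- The underlying additive group is `A`. -/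
def of : A ≃+ D.bimodule := AddEquiv.refl A

theorem tmul_smul (a : E) (b : Eᵐᵒᵖ) (x : A) :
    (a ⊗ₜ[k] b) • D.of x = D.of (D.p a * x * D.p b.unop) :=
  (tmul_smul_bimodule (D.p a) (op (D.p b.unop)) x)

/-- The inclusion as a morphism of bimodules. -/
noncomputable def incl : D.bimodule ⟶ regularBimodule k E :=
  tensorHom ((bimoduleCat.of k E E).toAddMonoidHom.comp
    (D.q.toAddMonoidHom.comp D.of.symm.toAddMonoidHom)) fun a b x => by
    obtain ⟨x, rfl⟩ := D.of.surjective x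
    rw [tmul_smul]
    refine Eq.trans ?_ (tmul_smul_bimodule a b (D.q x)).symm
    refine congrArg (bimoduleCat.of k E E) ?_
    change D.q (D.p a * x * D.p b.unop) = _
    rw [D.mul_q, D.q_mul]

/-- The projection as a morphism of bimodules. -/
noncomputable def proj : regularBimodule k E ⟶ D.bimodule :=
  tensorHom (X := bimoduleCat k E E) (D.of.toAddMonoidHom.comp
    (D.p.toRingHom.toAddMonoidHom.comp (bimoduleCat.of k E E).symm.toAddMonoidHom)) fun a b x => by
    obtain ⟨x, rfl⟩ := (bimoduleCat.of k E E).surjective x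
    rw [tmul_smul_bimodule]
    change D.of (D.p (a * x * b.unop)) = _ • D.of (D.p x)
    rw [tmul_smul, map_mul D.p, map_mul D.p]

theorem incl_proj : D.incl ≫ D.proj = 𝟙 _ := by
  ext x
  exact D.p_q _

/-- The central idempotent of the direct factor in the enveloping algebra. -/
noncomputable def idempotent : E ⊗[k] Eᵐᵒᵖ := D.q 1 ⊗ₜ[k] op (D.q 1)

theorem q_one_central (e : E) : D.q 1 * e = e * D.q 1 := by
  rw [← D.q_mul, ← D.mul_q, mul_one, one_mul]

theorem idempotent_central (r : E ⊗[k] Eᵐᵒᵖ) : D.idempotent * r = r * D.idempotent := by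
  induction r with
  | zero => rw [mul_zero, zero_mul]
  | tmul a b =>
    rw [idempotent, Algebra.TensorProduct.tmul_mul_tmul, Algebra.TensorProduct.tmul_mul_tmul,
      D.q_one_central, ← op_unop b, ← op_mul, ← op_mul, D.q_one_central]
  | add x y hx hy => rw [mul_add, add_mul, hx, hy]

theorem ext_eq_zero (D' : DirectFactor k E B) (h : D'.p (D.q 1) = 0) {n : ℕ}
    (x : Ext D.bimodule D'.bimodule n) : x = 0 := by
  refine ext_eq_zero_of_central D.idempotent D.idempotent_central (fun x => ?_) (fun x => ?_) x
  · obtain ⟨x, rfl⟩ := D.of.surjective x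
    rw [idempotent, tmul_smul, unop_op, D.p_q, one_mul, mul_one]
  · obtain ⟨x, rfl⟩ := D'.of.surjective x
    rw [idempotent, tmul_smul, unop_op, h, mul_zero, map_zero]

/-- The Hochschild cohomology of an algebra which is the product of two direct factors. -/
theorem nonempty_hochschildCohomology_linearEquiv_prod (D' : DirectFactor k E B)
    (h : D'.p (D.q 1) = 0) (h' : D.p (D'.q 1) = 0) (hadd : ∀ e, D.q (D.p e) + D'.q (D'.p e) = e)
    (n : ℕ) :
    Nonempty (HochschildCohomology k E n ≃ₗ[k]
      HochschildCohomology k A n × HochschildCohomology k B n) := by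
  have hc (a : A) : D'.p (D.q a) = 0 := by
    rw [← mul_one a, ← D.p_q a, D.q_mul, map_mul, h, mul_zero]
  have hc' (b : B) : D.p (D'.q b) = 0 := by
    rw [← mul_one b, ← D'.p_q b, D'.q_mul, map_mul, h', mul_zero]
  obtain ⟨e⟩ := nonempty_ext_linearEquiv_prod (k := k) D.incl_proj D'.incl_proj
    (by ext x; exact hc x) (by ext x; exact hc' x) (by ext x; exact hadd x)
    (n := n) (D.ext_eq_zero D' h) (D'.ext_eq_zero D h')
  exact ⟨e.trans ((D.extEquiv _ _ n).symm.prodCongr (D'.extEquiv _ _ n).symm)⟩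

end DirectFactor

/-! ### Null-square algebras -/

/-- The first factor of a product of algebras. -/
def DirectFactor.fst (k A B : Type u) [Field k] [Ring A] [Algebra k A] [Ring B] [Algebra k B] :
    DirectFactor k (A × B) A where
  p := AlgHom.fst k A B
  q := LinearMap.inl k A B
  p_q _ := rfl
  q_mul e a := by ext <;> simp
  mul_q e a := by ext <;> simp

/-- The second factor of a product of algebras. -/
def DirectFactor.snd (k A B : Type u) [Field k] [Ring A] [Algebra k A] [Ring B] [Algebra k B] :
    DirectFactor k (A × B) B where
  p := AlgHom.snd k A B
  q := LinearMap.inr k A B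
  p_q _ := rfl
  q_mul e a := by ext <;> simp
  mul_q e a := by ext <;> simp

theorem nonempty_hochschildCohomology_prod (k A B : Type u) [Field k] [Ring A] [Algebra k A]
    [Ring B] [Algebra k B] (n : ℕ) :
    Nonempty (HochschildCohomology k (A × B) n ≃ₗ[k]
      HochschildCohomology k A n × HochschildCohomology k B n) :=
  (DirectFactor.fst k A B).nonempty_hochschildCohomology_linearEquiv_prod (DirectFactor.snd k A B)
    rfl rfl (fun e => by ext <;> simp [DirectFactor.fst, DirectFactor.snd]) n

namespace CornerBimodule

variable {k : Type u} [Field k] {A B M N : Type u} [Ring A] [Algebra k A] [Ring B] [Algebra k B]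
  [AddCommGroup M] [Module k M] [Module B M] [Module Aᵐᵒᵖ M] [SMulCommClass B Aᵐᵒᵖ M]
  [IsScalarTower k B M] [IsScalarTower k Aᵐᵒᵖ M]
  [AddCommGroup N] [Module k N] [Module A N] [Module Bᵐᵒᵖ N] [SMulCommClass A Bᵐᵒᵖ N]
  [IsScalarTower k A N] [IsScalarTower k Bᵐᵒᵖ N]

/-- The idempotent `e_A ⊗ e_A + e_B ⊗ e_B` acts by one on the diagonal bimodule `A × B` and by zero
on the off-diagonal bimodule `M ⊕ N`. -/
theorem ext_regularBimodule_eq_zero {n : ℕ}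
    (x : Abelian.Ext (regularBimodule k (A × B)) (bimoduleCat k (A × B) (CornerBimodule M N)) n) :
    x = 0 := by
  refine ext_eq_zero_of_central
    ((DirectFactor.fst k A B).idempotent + (DirectFactor.snd k A B).idempotent)
    (fun r => ?_) (fun x => ?_) (fun x => ?_) x
  · rw [add_mul, mul_add, DirectFactor.idempotent_central, DirectFactor.idempotent_central]
  · obtain ⟨x, rfl⟩ := (bimoduleCat.of k (A × B) (A × B)).surjective x
    refine (add_smul (R := (A × B) ⊗[k] (A × B)ᵐᵒᵖ) (M := bimoduleCat k (A × B) (A × B))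
      _ _ _).trans ?_
    rw [DirectFactor.idempotent, DirectFactor.idempotent, tmul_smul_bimodule, tmul_smul_bimodule,
      ← map_add]
    refine congrArg (bimoduleCat.of k (A × B) (A × B)) ?_
    ext <;> simp [DirectFactor.fst, DirectFactor.snd]
  · obtain ⟨x, rfl⟩ := (bimoduleCat.of k (A × B) (CornerBimodule M N)).surjective x
    rw [add_smul, DirectFactor.idempotent, DirectFactor.idempotent, bimoduleCat.tmul_smul,
      bimoduleCat.tmul_smul, ← map_add, ← map_zero (bimoduleCat.of k (A × B) (CornerBimodule M N))]
    refine congrArg (bimoduleCat.of k (A × B) (CornerBimodule M N)) ?_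
    ext <;> simp [DirectFactor.fst, DirectFactor.snd]

end CornerBimodule

/-- The null-square algebra as the trivial extension of `A × B` by `M ⊕ N`. -/
def NullSquareAlgebra.trivialExtension (k A B M N : Type u) [Field k] [Ring A] [Algebra k A]
    [Ring B] [Algebra k B] [AddCommGroup M] [Module k M] [Module B M] [Module Aᵐᵒᵖ M]
    [SMulCommClass B Aᵐᵒᵖ M] [IsScalarTower k B M] [IsScalarTower k Aᵐᵒᵖ M]
    [AddCommGroup N] [Module k N] [Module A N] [Module Bᵐᵒᵖ N] [SMulCommClass A Bᵐᵒᵖ N]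
    [IsScalarTower k A N] [IsScalarTower k Bᵐᵒᵖ N] :
    TrivialExtension k (A × B) (CornerBimodule M N) (NullSquareAlgebra A N M B) where
  ι := AlgHom.ofLinearMap
    { toFun := fun x => ⟨x.1, 0, 0, x.2⟩
      map_add' := fun x y => by ext <;> simp
      map_smul' := fun c x => by ext <;> simp } rfl (fun x y => by ext <;> simp)
  π := AlgHom.ofLinearMap
    { toFun := fun x => (x.a, x.b)
      map_add' := fun x y => rfl
      map_smul' := fun c x => rfl } rfl (fun x y => rfl)
  j :=
    { toFun := fun v => ⟨0, v.n, v.m, 0⟩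
      map_add' := fun x y => by ext <;> simp
      map_smul' := fun c x => by ext <;> simp }
  ρ :=
    { toFun := fun x => ⟨x.m, x.n⟩
      map_add' := fun x y => rfl
      map_smul' := fun c x => rfl }
  decomp x := NullSquareAlgebra.ext (add_zero _) (zero_add _) (zero_add _) (add_zero _)
  π_ι e := rfl
  ρ_ι e := rfl
  π_j m := rfl
  ρ_j m := rfl
  ρ_mul x y := CornerBimodule.ext (add_comm _ _) rfl

theorem mainTheorem8
    {k : Type u} [Field k]
    {A B M N : Type u} [Ring A] [Algebra k A] [Ring B] [Algebra k B]
    -- `M` is a `B`-`A`-bimodule and `N` is an `A`-`B`-bimodule, with `k` acting centrally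
    [AddCommGroup M] [Module k M] [Module B M] [Module Aᵐᵒᵖ M] [SMulCommClass B Aᵐᵒᵖ M]
    [IsScalarTower k B M] [IsScalarTower k Aᵐᵒᵖ M]
    [AddCommGroup N] [Module k N] [Module A N] [Module Bᵐᵒᵖ N] [SMulCommClass A Bᵐᵒᵖ N]
    [IsScalarTower k A N] [IsScalarTower k Bᵐᵒᵖ N]
    (hproj : IsProjectiveBimodule k (A × B) (A × B) (CornerBimodule M N)) :
    (Module.Finite k (NullSquareAlgebra A N M B) →
      ∀ n : ℕ, 0 < n →
        Module.rank k (HochschildCohomology k A n) + Module.rank k (HochschildCohomology k B n) ≤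
          Module.rank k (HochschildCohomology k (NullSquareAlgebra A N M B) n)) ∧
    (∀ h : ℕ, 0 < h → Subsingleton (BimoduleTensorPower k (A × B) (CornerBimodule M N) h) →
      ∀ n : ℕ, h ≤ n →
        Nonempty (HochschildCohomology k (NullSquareAlgebra A N M B) n ≃ₗ[k]
          HochschildCohomology k A n × HochschildCohomology k B n)) := by
  let D := NullSquareAlgebra.trivialExtension k A B M N
  refine ⟨fun _ n hn => ?_, fun h h0 hh n hn => ?_⟩
  · obtain ⟨e⟩ := nonempty_hochschildCohomology_prod k A B n
    obtain ⟨n, rfl⟩ := Nat.exists_eq_add_of_le' hn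
    rw [← rank_prod']
    exact e.rank_eq.symm.trans_le
      (LinearMap.rank_le_of_surjective _ (D.restriction_surjective hproj n))
  · obtain ⟨e⟩ := nonempty_hochschildCohomology_prod k A B n
    have hinj := D.restriction_injective hproj
      (fun _ => CornerBimodule.ext_regularBimodule_eq_zero) h0 hh hn
    obtain ⟨n, rfl⟩ := Nat.exists_eq_add_of_le' (h0.trans_le hn)
    exact ⟨(LinearEquiv.ofBijective (D.restriction (n + 1))
      ⟨hinj, D.restriction_surjective hproj n⟩).trans e⟩
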